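/- Let $A$ be a (not necessarily unital) $C^*$-algebra. An associative Hilbert $C^*$-$A$-$A$-bimodule is a Banach space $M$ with commuting left and right actions of $A$, both non-degenerate ($AM$ and $MA$ span dense subspaces of $M$), a left $A$-valued inner product ${}_A\langle\cdot,\cdot\rangle$ and a right $A$-valued inner product $\langle\cdot,\cdot\rangle_A$ making $M$ a left and a right Hilbert $C^*$-module over $A$, such that $\langle am,n\rangle_A=\langle m,a^*n\rangle_A$ and ${}_A\langle ma,n\rangle={}_A\langle m,na^*\rangle$, the norm of $M$ is equivalent to both $\|{}_A\langle m,m\rangle\|^{1/2}$ and $\|\langle m,m\rangle_A\|^{1/2}$, and ${}_A\langle m,n\rangle r=m\langle n,r\rangle_A$ for all $m,n,r\in M$, $a\in A$. It is not required to be full. An isomorphism of such bimodules is a bicontinuous linear bijection that preserves both actions and both inner products. Let $S(A)$ be the set of isomorphism classes $[M]$ of associative Hilbert $C^*$-$A$-$A$-bimodules. For two such bimodules $M,N$ the interior tensor product $M\otimes_A N$ is the separated completion of the algebraic tensor product with respect to the inner products determined by ${}_A\langle m\otimes n,m'\otimes n'\rangle={}_A\langle m\,{}_A\langle n,n'\rangle,m'\rangle$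 and $\langle m\otimes n,m'\otimes n'\rangle_A=\langle n,\langle m,m'\rangle_A n'\rangle_A$. It is again an associative Hilbert $C^*$-$A$-$A$-bimodule, and $[M]\cdot[N]=[M\otimes_A N]$ is a well-defined multiplication on $S(A)$. A closed two-sided ideal $J\subseteq A$ is an associative Hilbert $C^*$-$A$-$A$-bimodule with the multiplication of $A$ as actions and the inner products ${}_A\langle x,y\rangle=xy^*$, $\langle x,y\rangle_A=x^*y$. **Theorem.** $S(A)$ is an inverse semigroup, i.e. its multiplication is associative and for each $s\in S(A)$ there is exactly one $t\in S(A)$ with $sts=s$ and $tst=t$. In particular $S(A)$ is regular. Moreover, $J\mapsto[J]$ is a bijection from the closed two-sided ideals of $A$ onto the idempotents of $S(A)$, $[I]\cdot[J]=[I\cap J]$ for all closed two-sided ideals $I,J$, and any two idempotents of $S(A)$ commute. -/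

import Mathlib

open scoped TensorProduct CStarAlgebra
open Filter Topology
open UniformSpace (Completion)

universe u

namespace CStarBimod

section Aux

variable {A : Type*} [NonUnitalCStarAlgebra A] [PartialOrder A] [StarOrderedRing A]

/-- The Cauchy-Schwarz estimate for semi-inner products. -/
theorem norm_sq_le_of_quadratic {p q r : A} (hp : IsSelfAdjoint p)
    (h : ∀ t : ℝ, 0 ≤ t ^ 2 • (star r * p * r) - (2 * t) • (star r * r) + q) :
    ‖r‖ ^ 2 ≤ ‖p‖ * ‖q‖ := by
  have key : ∀ ε : ℝ, 0 < ε → ‖r‖ ^ 2 ≤ (‖p‖ + ε) * ‖q‖ := by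
    intro ε hε
    have hpos : 0 < ‖p‖ + ε := by positivity
    set t : ℝ := (‖p‖ + ε)⁻¹ with ht
    have htpos : 0 < t := by positivity
    have h1 : star r * p * r ≤ ‖p‖ • (star r * r) :=
      CStarAlgebra.star_left_conjugate_le_norm_smul hp
    have hrr : 0 ≤ star r * r := star_mul_self_nonneg r
    have h2 : t ^ 2 • (star r * p * r) ≤ t • (star r * r) := by
      calc t ^ 2 • (star r * p * r) ≤ t ^ 2 • (‖p‖ • (star r * r)) :=
            smul_le_smul_of_nonneg_left h1 (by positivity)
        _ = (t ^ 2 * ‖p‖) • (star r * r) := by rw [smul_smul]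
        _ ≤ t • (star r * r) := by
            refine smul_le_smul_of_nonneg_right ?_ hrr
            have : t * ‖p‖ ≤ 1 := by
              rw [ht, inv_mul_le_iff₀ hpos]; linarith
            nlinarith
    have h3 : t • (star r * r) ≤ q := by
      have := h t
      have e : (2 * t) • (star r * r) = t • (star r * r) + t • (star r * r) := by
        rw [← add_smul]; ring_nf
      rw [e] at this
      have h4 : t ^ 2 • (star r * p * r) - (t • (star r * r) + t • (star r * r)) + q
          ≤ t • (star r * r) - (t • (star r * r) + t • (star r * r)) + q := by gcongr
      have h5 := this.trans h4
      rw [← sub_nonneg]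
      convert h5 using 1
      abel
    have h6 : ‖t • (star r * r)‖ ≤ ‖q‖ :=
      CStarAlgebra.norm_le_norm_of_nonneg_of_le (smul_nonneg htpos.le hrr) h3
    rw [norm_smul, CStarRing.norm_star_mul_self, Real.norm_of_nonneg htpos.le, ht,
      inv_mul_le_iff₀ hpos] at h6
    linarith [h6, sq ‖r‖]
  have hlim : Tendsto (fun ε : ℝ => (‖p‖ + ε) * ‖q‖) (𝓝[>] 0) (𝓝 ((‖p‖ + 0) * ‖q‖)) :=
    Tendsto.mono_left (Continuous.tendsto (by fun_prop) 0) nhdsWithin_le_nhds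
  rw [add_zero] at hlim
  exact ge_of_tendsto hlim (eventually_nhdsWithin_of_forall fun ε hε => key ε hε)

end Aux

/-- The bound behind the contractivity of actions on semi-inner product modules. -/
theorem norm_map_star_mul_le {A : Type*} [NonUnitalCStarAlgebra A] {B : Type*} [NonUnitalCStarAlgebra B] [PartialOrder B]
    [StarOrderedRing B] (v : B) (f : A →ₗ[ℂ] B)
    (hpos : ∀ d : A, 0 ≤ f (star d * d))
    (h : ∀ (z : ℂ) (d : A),
      0 ≤ (star z * z) • v + f (star z • d + z • star d + star d * d)) (a : A) :
    ‖f (star a * a)‖ ≤ ‖a‖ ^ 2 * ‖v‖ := by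
  have h1 : star (a : A⁺¹) * (a : A⁺¹) ≤ algebraMap ℝ A⁺¹ (‖(a : A⁺¹)‖ ^ 2) :=
    CStarAlgebra.star_mul_le_algebraMap_norm_sq
  rw [Unitization.norm_inr] at h1
  obtain ⟨w, hw⟩ := CStarAlgebra.nonneg_iff_eq_star_mul_self.mp (sub_nonneg.mpr h1)
  have hw' := sub_eq_iff_eq_add.mp hw
  rw [Algebra.algebraMap_eq_smul_one] at hw'
  have hfst : (((‖a‖ ^ 2 : ℝ) : ℂ)) = star w.fst * w.fst := by
    have := congrArg (fun x : A⁺¹ => x.fst) hw'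
    simpa [Unitization.fst_mul, Unitization.fst_add, Unitization.fst_smul] using this
  have hsnd : star w.fst • w.snd + w.fst • star w.snd + star w.snd * w.snd = -(star a * a) := by
    have := congrArg (fun x : A⁺¹ => x.snd) hw'
    rw [eq_neg_iff_add_eq_zero]
    simpa [Unitization.snd_mul, Unitization.snd_add, Unitization.snd_smul] using this.symm
  have h2 := h w.fst w.snd
  rw [hsnd, ← hfst, map_neg, ← sub_eq_add_neg, sub_nonneg] at h2
  have h3 := CStarAlgebra.norm_le_norm_of_nonneg_of_le (hpos a) h2
  simpa [norm_smul] using h3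

section Aux

variable {A : Type*} [NonUnitalCStarAlgebra A] [PartialOrder A] [StarOrderedRing A]

/-- The decomposition of a selfadjoint element, in terms of the star ring structure only. -/
theorem exists_negPart {C : Type*} [NonUnitalCStarAlgebra C] {M : C} (hM : IsSelfAdjoint M) :
    ∃ N w s : C, N = star w * w ∧ N * M * N = -(N * N * N) ∧ (N = 0 → M = star s * s) := by
  let _ : PartialOrder C := CStarAlgebra.spectralOrder C
  have _ : StarOrderedRing C := CStarAlgebra.spectralOrderedRing C
  obtain ⟨w, hw⟩ := CStarAlgebra.nonneg_iff_eq_star_mul_self.mp (CFC.negPart_nonneg M)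
  obtain ⟨s, hs⟩ := CStarAlgebra.nonneg_iff_eq_star_mul_self.mp (CFC.posPart_nonneg M)
  refine ⟨M⁻, w, s, hw, ?_, fun h => ?_⟩
  · have : M⁻ * (M⁺ - M⁻) * M⁻ = -(M⁻ * M⁻ * M⁻) := by
      rw [mul_sub, CFC.negPart_mul_posPart, zero_sub, neg_mul]
    rwa [CFC.posPart_sub_negPart M hM] at this
  · rw [← hs, ← sub_zero M⁺, ← h, CFC.posPart_sub_negPart M hM]

/-- A positive matrix over a C⋆-algebra is of the form `s⋆ s`. -/
theorem exists_gram {ι : Type*} [Fintype ι] (G : ι → ι → A) (hG : ∀ i j, star (G i j) = G j i)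
    (h : ∀ b : ι → A, 0 ≤ ∑ i, ∑ j, star (b i) * G i j * b j) :
    ∃ s : ι → ι → A, ∀ i j, G i j = ∑ k, star (s k i) * s k j := by
  let M : CStarMatrix ι ι A := CStarMatrix.ofMatrix (Matrix.of G)
  have hMent : ∀ i j, M i j = G i j := fun i j => rfl
  have hM : IsSelfAdjoint M := by
    ext i j
    rw [CStarMatrix.star_apply]
    exact hG j i
  obtain ⟨N, w, s, hw, hNMN, hs⟩ := exists_negPart hM
  have hNs : star N = N := by rw [hw, star_mul, star_star]
  have hcube : N * N * N = star (w * N) * (w * N) := by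
    rw [star_mul, hNs, mul_assoc N (star w), ← mul_assoc (star w), ← hw, mul_assoc]
  have hz : w * N = 0 := by
    have hdiag : ∀ k, ∑ i, star ((w * N) i k) * (w * N) i k = 0 := by
      intro k
      have h1 : (star (w * N) * (w * N)) k k = ∑ i, star ((w * N) i k) * (w * N) i k := by
        rw [CStarMatrix.mul_apply]; rfl
      have h2 : (N * M * N) k k = ∑ i, ∑ j, star (N i k) * G i j * N j k := by
        rw [CStarMatrix.mul_apply]
        simp_rw [CStarMatrix.mul_apply, Finset.sum_mul]
        rw [Finset.sum_comm]
        refine Finset.sum_congr rfl fun i _ => Finset.sum_congr rfl fun j _ => ?_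
        rw [hMent]
        congr 2
        conv_lhs => rw [← hNs]
        rfl
      have h3 : 0 ≤ (N * M * N) k k := by rw [h2]; exact h fun i => N i k
      rw [hNMN, hcube, CStarMatrix.neg_apply, h1] at h3
      exact le_antisymm (neg_nonneg.mp h3) (Finset.sum_nonneg fun i _ => star_mul_self_nonneg _)
    ext i k
    have := (Finset.sum_eq_zero_iff_of_nonneg (fun i _ => star_mul_self_nonneg _)).mp
      (hdiag k) i (Finset.mem_univ _)
    exact CStarRing.star_mul_self_eq_zero_iff _ |>.mp this
  have hN2 : N * N = 0 := by
    have e : N * N = star w * (w * N) := by rw [← mul_assoc, ← hw]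
    rw [e, hz, mul_zero]
  have hN0 : N = 0 := by
    rw [← CStarRing.star_mul_self_eq_zero_iff, hNs, hN2]
  refine ⟨fun i j => s i j, fun i j => ?_⟩
  rw [← hMent, hs hN0, CStarMatrix.mul_apply]
  rfl

theorem mem_closure_range_left {E : Type*} [SeminormedAddCommGroup E] (g : A → E) (x : E) (v : A)
    (h : ∀ a, ‖x - g a‖ ^ 2 ≤ ‖v - a * v‖ * (1 + ‖a‖)) : x ∈ closure (Set.range g) := by
  have hl := CStarAlgebra.increasingApproximateUnit A
  have h1 : Tendsto (fun a : A => ‖v - a * v‖) (CStarAlgebra.approximateUnit A) (𝓝 0) := by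
    have := (hl.tendsto_mul_right v).const_sub v
    simpa using this.norm
  have h2 : Tendsto (fun a : A => ‖x - g a‖ ^ 2) (CStarAlgebra.approximateUnit A) (𝓝 0) := by
    refine squeeze_zero' (Eventually.of_forall fun _ => by positivity)
      (hl.eventually_norm.mono fun a ha => (h a).trans ?_) (by simpa using h1.mul_const 2)
    gcongr; linarith
  have h3 : Tendsto (fun a : A => g a) (CStarAlgebra.approximateUnit A) (𝓝 x) := by
    rw [tendsto_iff_norm_sub_tendsto_zero]
    have := h2.sqrt
    simpa [Real.sqrt_sq, norm_sub_rev] using this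
  exact mem_closure_of_tendsto h3 (Eventually.of_forall fun a => Set.mem_range_self a)

theorem mem_closure_range_right {E : Type*} [SeminormedAddCommGroup E] (g : A → E) (x : E) (v : A)
    (h : ∀ a, ‖x - g a‖ ^ 2 ≤ ‖v - v * a‖ * (1 + ‖a‖)) : x ∈ closure (Set.range g) := by
  have hcl := mem_closure_range_left (fun a => g (star a)) x (star v) (fun a => by
    have := h (star a)
    rwa [← norm_star (v - _), star_sub, star_mul, star_star, norm_star] at this)
  refine closure_mono ?_ hcl
  rintro _ ⟨a, rfl⟩
  exact ⟨star a, rfl⟩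

end Aux

/-- An associative Hilbert C⋆-bimodule, left over `A` and right over `B`. The left action of `a` on
`m` is `lact a m`, the right action of `b` on `m` is `ract b m` (this is `m b`). The left inner
product `linner` is linear in the first variable, the right inner product `rinner` is linear in the
second one. The bimodule is not required to be full. Completeness in the Hilbert module norms
follows from completeness in the given norm and the equivalence of the norms. -/
structure HilbertBimodule (A B : Type u) [NonUnitalCStarAlgebra A] [PartialOrder A]
    [StarOrderedRing A] [NonUnitalCStarAlgebra B] [PartialOrder B] [StarOrderedRing B] where
  /-- the underlying Banach space -/
  carrier : Type u
  [normedAddCommGroup : NormedAddCommGroup carrier]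
  [normedSpace : NormedSpace ℂ carrier]
  [completeSpace : CompleteSpace carrier]
  /-- the left action `a m` -/
  lact : A →ₗ[ℂ] carrier →ₗ[ℂ] carrier
  /-- the right action `m b`, written `ract b m` -/
  ract : B →ₗ[ℂ] carrier →ₗ[ℂ] carrier
  lact_mul : ∀ a a' m, lact (a * a') m = lact a (lact a' m)
  ract_mul : ∀ b b' m, ract (b * b') m = ract b' (ract b m)
  lact_ract : ∀ a b m, ract b (lact a m) = lact a (ract b m)
  lact_nondegenerate :
    Dense (Submodule.span ℂ {x : carrier | ∃ a m, lact a m = x} : Set carrier)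
  ract_nondegenerate :
    Dense (Submodule.span ℂ {x : carrier | ∃ b m, ract b m = x} : Set carrier)
  /-- the left inner product, with values in `A` -/
  linner : carrier →ₗ[ℂ] carrier →ₗ⋆[ℂ] A
  /-- the right inner product, with values in `B` -/
  rinner : carrier →ₗ⋆[ℂ] carrier →ₗ[ℂ] B
  star_linner : ∀ m n, star (linner m n) = linner n m
  star_rinner : ∀ m n, star (rinner m n) = rinner n m
  linner_lact : ∀ a m n, linner (lact a m) n = a * linner m n
  rinner_ract : ∀ b m n, rinner m (ract b n) = rinner m n * b
  linner_self_nonneg : ∀ m, 0 ≤ linner m m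
  rinner_self_nonneg : ∀ m, 0 ≤ rinner m m
  linner_definite : ∀ m, linner m m = 0 → m = 0
  rinner_definite : ∀ m, rinner m m = 0 → m = 0
  rinner_lact : ∀ a m n, rinner (lact a m) n = rinner m (lact (star a) n)
  linner_ract : ∀ b m n, linner (ract b m) n = linner m (ract (star b) n)
  /-- the given norm is equivalent to the norm of the left Hilbert module -/
  norm_equiv_linner : ∃ c C : ℝ, 0 < c ∧ 0 < C ∧
    ∀ m, c * ‖m‖ ≤ √‖linner m m‖ ∧ √‖linner m m‖ ≤ C * ‖m‖
  /-- the given norm is equivalent to the norm of the right Hilbert module -/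
  norm_equiv_rinner : ∃ c C : ℝ, 0 < c ∧ 0 < C ∧
    ∀ m, c * ‖m‖ ≤ √‖rinner m m‖ ∧ √‖rinner m m‖ ≤ C * ‖m‖
  /-- associativity `⟨m, n⟩ r = m ⟨n, r⟩` -/
  linner_lact_eq : ∀ m n r, lact (linner m n) r = ract (rinner n r) m

attribute [instance] HilbertBimodule.normedAddCommGroup HilbertBimodule.normedSpace
  HilbertBimodule.completeSpace

/-- An algebraic bimodule with `A`- and `B`-valued semi-inner products, from which a Hilbert
bimodule is obtained by separation and completion. -/
structure PreBimodule (A B : Type u) [NonUnitalCStarAlgebra A] [PartialOrder A]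
    [StarOrderedRing A] [NonUnitalCStarAlgebra B] [PartialOrder B] [StarOrderedRing B] where
  /-- the underlying vector space -/
  carrier : Type u
  [addCommGroup : AddCommGroup carrier]
  [module : Module ℂ carrier]
  /-- the left action `a m` -/
  lact : A →ₗ[ℂ] carrier →ₗ[ℂ] carrier
  /-- the right action `m b`, written `ract b m` -/
  ract : B →ₗ[ℂ] carrier →ₗ[ℂ] carrier
  lact_mul : ∀ a a' m, lact (a * a') m = lact a (lact a' m)
  ract_mul : ∀ b b' m, ract (b * b') m = ract b' (ract b m)
  lact_ract : ∀ a b m, ract b (lact a m) = lact a (ract b m)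
  /-- the left semi-inner product, with values in `A` -/
  linner : carrier →ₗ[ℂ] carrier →ₗ⋆[ℂ] A
  /-- the right semi-inner product, with values in `B` -/
  rinner : carrier →ₗ⋆[ℂ] carrier →ₗ[ℂ] B
  star_linner : ∀ m n, star (linner m n) = linner n m
  star_rinner : ∀ m n, star (rinner m n) = rinner n m
  linner_lact : ∀ a m n, linner (lact a m) n = a * linner m n
  rinner_ract : ∀ b m n, rinner m (ract b n) = rinner m n * b
  linner_self_nonneg : ∀ m, 0 ≤ linner m m
  rinner_self_nonneg : ∀ m, 0 ≤ rinner m m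
  rinner_lact : ∀ a m n, rinner (lact a m) n = rinner m (lact (star a) n)
  linner_ract : ∀ b m n, linner (ract b m) n = linner m (ract (star b) n)
  rinner_assoc : ∀ w m n r, rinner w (lact (linner m n) r) = rinner w (ract (rinner n r) m)
  linner_assoc : ∀ w m n r, linner (lact (linner m n) r) w = linner (ract (rinner n r) m) w

attribute [instance] PreBimodule.addCommGroup PreBimodule.module

variable {A B C : Type u} [NonUnitalCStarAlgebra A] [PartialOrder A] [StarOrderedRing A]
  [NonUnitalCStarAlgebra B] [PartialOrder B] [StarOrderedRing B]
  [NonUnitalCStarAlgebra C] [PartialOrder C] [StarOrderedRing C]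

namespace PreBimodule

variable (P : PreBimodule A B)

theorem rinner_ract_left (b : B) (m n : P.carrier) :
    P.rinner (P.ract b m) n = star b * P.rinner m n := by
  rw [← P.star_rinner, P.rinner_ract, star_mul, P.star_rinner]

theorem linner_lact_right (a : A) (m n : P.carrier) :
    P.linner m (P.lact a n) = P.linner m n * star a := by
  rw [← P.star_linner, P.linner_lact, star_mul, P.star_linner]

theorem norm_rinner_sq_le (x y : P.carrier) :
    ‖P.rinner x y‖ ^ 2 ≤ ‖P.rinner x x‖ * ‖P.rinner y y‖ := by
  refine norm_sq_le_of_quadratic (P.star_rinner x x) fun t => ?_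
  have h := P.rinner_self_nonneg ((t : ℂ) • P.ract (P.rinner x y) x - y)
  convert h using 1
  simp only [map_sub, map_smulₛₗ, LinearMap.sub_apply, LinearMap.smul_apply, P.rinner_ract,
    P.rinner_ract_left, P.star_rinner, RingHom.id_apply, Complex.conj_ofReal]
  simp only [smul_sub, two_mul, smul_smul, add_smul, sq, mul_assoc, Complex.coe_smul]
  abel

theorem norm_linner_sq_le (x y : P.carrier) :
    ‖P.linner x y‖ ^ 2 ≤ ‖P.linner x x‖ * ‖P.linner y y‖ := by
  refine norm_sq_le_of_quadratic (P.star_linner x x) fun t => ?_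
  have h := P.linner_self_nonneg ((t : ℂ) • P.lact (P.linner y x) x - y)
  convert h using 1
  simp only [map_sub, map_smulₛₗ, LinearMap.sub_apply, LinearMap.smul_apply, P.linner_lact,
    P.linner_lact_right, P.star_linner, RingHom.id_apply, Complex.conj_ofReal]
  simp only [smul_sub, two_mul, smul_smul, add_smul, sq, mul_assoc, Complex.coe_smul]
  abel

theorem norm_rinner_lact_le (a : A) (x : P.carrier) :
    ‖P.rinner (P.lact a x) (P.lact a x)‖ ≤ ‖a‖ ^ 2 * ‖P.rinner x x‖ := by
  rw [P.rinner_lact, ← P.lact_mul]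
  refine norm_map_star_mul_le (P.rinner x x) (P.rinner x ∘ₗ P.lact.flip x) (fun d => ?_)
    (fun z d => ?_) a
  · simpa [P.lact_mul, ← P.rinner_lact] using P.rinner_self_nonneg (P.lact d x)
  · convert P.rinner_self_nonneg (z • x + P.lact d x) using 1
    simp only [map_add, map_smulₛₗ, LinearMap.add_apply, LinearMap.smul_apply, RingHom.id_apply,
      LinearMap.comp_apply, LinearMap.flip_apply, P.lact_mul, P.rinner_lact, smul_add, smul_smul,
      starRingEnd_apply, mul_comm (star z)]
    abel

theorem norm_linner_ract_le (b : B) (x : P.carrier) :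
    ‖P.linner (P.ract b x) (P.ract b x)‖ ≤ ‖b‖ ^ 2 * ‖P.linner x x‖ := by
  have e : P.linner (P.ract b x) (P.ract b x) =
      P.linner.flip x (P.ract (star (star b) * star b) x) := by
    rw [← P.star_linner, P.linner_ract, ← P.ract_mul, P.star_linner, star_star,
      LinearMap.flip_apply]
  rw [e, ← norm_star b]
  refine norm_map_star_mul_le (P.linner x x) (P.linner.flip x ∘ₗ P.ract.flip x) (fun d => ?_)
    (fun z d => ?_) (star b)
  · have := P.linner_self_nonneg (P.ract (star d) x)
    rw [← P.star_linner, P.linner_ract, ← P.ract_mul, P.star_linner, star_star] at this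
    simpa using this
  · convert P.linner_self_nonneg (star z • x + P.ract (star d) x) using 1
    simp only [map_add, map_smulₛₗ, LinearMap.add_apply, LinearMap.smul_apply, RingHom.id_apply,
      LinearMap.comp_apply, LinearMap.flip_apply, P.ract_mul, P.linner_ract, smul_add, smul_smul,
      starRingEnd_apply, star_star]
    rw [mul_comm z]
    abel

theorem norm_linner_self (x : P.carrier) : ‖P.linner x x‖ = ‖P.rinner x x‖ := by
  apply le_antisymm
  · by_contra! hlt
    have h1 : ‖P.linner x x‖ * ‖P.linner x x‖ =
        ‖P.linner (P.ract (P.rinner x x) x) x‖ := by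
      rw [← P.linner_assoc, P.linner_lact, ← CStarRing.norm_star_mul_self, P.star_linner]
    have h2 := P.norm_linner_sq_le (P.ract (P.rinner x x) x) x
    rw [← h1] at h2
    have h3 := P.norm_linner_ract_le (P.rinner x x) x
    have h0 := norm_nonneg (P.rinner x x)
    have hL : 0 < ‖P.linner x x‖ := h0.trans_lt hlt
    have h4 : (‖P.linner x x‖ * ‖P.linner x x‖) ^ 2 ≤
        (‖P.rinner x x‖ * ‖P.linner x x‖) ^ 2 := by
      nlinarith
    have h5 := (pow_le_pow_iff_left₀ (by positivity) (by positivity) two_ne_zero).mp h4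
    nlinarith
  · by_contra! hlt
    have h1 : ‖P.rinner x x‖ * ‖P.rinner x x‖ =
        ‖P.rinner x (P.lact (P.linner x x) x)‖ := by
      rw [P.rinner_assoc, P.rinner_ract, ← CStarRing.norm_star_mul_self, P.star_rinner]
    have h2 := P.norm_rinner_sq_le x (P.lact (P.linner x x) x)
    rw [← h1] at h2
    have h3 := P.norm_rinner_lact_le (P.linner x x) x
    have h0 := norm_nonneg (P.linner x x)
    have hL : 0 < ‖P.rinner x x‖ := h0.trans_lt hlt
    have h4 : (‖P.rinner x x‖ * ‖P.rinner x x‖) ^ 2 ≤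
        (‖P.linner x x‖ * ‖P.rinner x x‖) ^ 2 := by
      nlinarith
    have h5 := (pow_le_pow_iff_left₀ (by positivity) (by positivity) two_ne_zero).mp h4
    nlinarith

noncomputable instance : Norm P.carrier := ⟨fun x => √‖P.rinner x x‖⟩

theorem norm_def (x : P.carrier) : ‖x‖ = √‖P.rinner x x‖ := rfl

theorem norm_def' (x : P.carrier) : ‖x‖ = √‖P.linner x x‖ := by rw [norm_linner_self]; rfl

theorem norm_rinner_le (x y : P.carrier) : ‖P.rinner x y‖ ≤ ‖x‖ * ‖y‖ := by
  rw [norm_def, norm_def, ← Real.sqrt_mul (norm_nonneg _)]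
  exact Real.le_sqrt_of_sq_le (P.norm_rinner_sq_le x y)

theorem norm_linner_le (x y : P.carrier) : ‖P.linner x y‖ ≤ ‖x‖ * ‖y‖ := by
  rw [norm_def', norm_def', ← Real.sqrt_mul (norm_nonneg _)]
  exact Real.le_sqrt_of_sq_le (P.norm_linner_sq_le x y)

theorem seminormedCore : SeminormedSpace.Core ℂ P.carrier where
  norm_nonneg x := Real.sqrt_nonneg _
  norm_smul c x := by
    simp only [norm_def, map_smulₛₗ, LinearMap.smul_apply, norm_smul, RingHom.id_apply]
    rw [← mul_assoc, Real.sqrt_mul (by positivity)]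
    congr 1
    rw [RCLike.norm_conj, Real.sqrt_mul_self (norm_nonneg _)]
  norm_triangle x y := by
    have hx : ‖x‖ ^ 2 = ‖P.rinner x x‖ := Real.sq_sqrt (norm_nonneg _)
    have hy : ‖y‖ ^ 2 = ‖P.rinner y y‖ := Real.sq_sqrt (norm_nonneg _)
    have h1 := P.norm_rinner_le x y
    have h2 := P.norm_rinner_le y x
    rw [norm_def P (x + y)]
    refine Real.sqrt_le_iff.mpr ⟨add_nonneg (Real.sqrt_nonneg _) (Real.sqrt_nonneg _), ?_⟩
    calc ‖P.rinner (x + y) (x + y)‖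
        = ‖P.rinner x x + P.rinner x y + (P.rinner y x + P.rinner y y)‖ := by
          simp only [map_add, LinearMap.add_apply]
          congr 1; abel
      _ ≤ ‖P.rinner x x‖ + ‖P.rinner x y‖ + (‖P.rinner y x‖ + ‖P.rinner y y‖) := by
          refine (norm_add_le _ _).trans ?_
          gcongr <;> exact norm_add_le _ _
      _ ≤ (‖x‖ + ‖y‖) ^ 2 := by nlinarith

noncomputable instance : SeminormedAddCommGroup P.carrier :=
  SeminormedAddCommGroup.ofCore P.seminormedCore

noncomputable instance : NormedSpace ℂ P.carrier where
  norm_smul_le c x := (P.seminormedCore.norm_smul c x).le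

theorem norm_lact_le (a : A) (x : P.carrier) : ‖P.lact a x‖ ≤ ‖a‖ * ‖x‖ := by
  rw [norm_def]
  refine Real.sqrt_le_iff.mpr ⟨by positivity, (P.norm_rinner_lact_le a x).trans ?_⟩
  rw [mul_pow, norm_def P x, Real.sq_sqrt (norm_nonneg _)]

theorem norm_ract_le (b : B) (x : P.carrier) : ‖P.ract b x‖ ≤ ‖b‖ * ‖x‖ := by
  rw [norm_def']
  refine Real.sqrt_le_iff.mpr ⟨by positivity, (P.norm_linner_ract_le b x).trans ?_⟩
  rw [mul_pow, norm_def' P x, Real.sq_sqrt (norm_nonneg _)]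

/-- The separated completion for the seminorm `x ↦ ‖⟨x, x⟩‖ ^ (1 / 2)`. -/
abbrev Compl : Type u := UniformSpace.Completion P.carrier

end PreBimodule

section Extend

variable {E F : Type*} [SeminormedAddCommGroup E] [NormedSpace ℂ E] [NormedAddCommGroup F]
  [NormedSpace ℂ F] [CompleteSpace F] {σ τ : ℂ →+* ℂ} [RingHomIsometric σ] [RingHomIsometric τ]

/-- The extension to the completion of a bounded sesquilinear map. -/
noncomputable def extend₂ (f : E →ₛₗ[σ] E →ₛₗ[τ] F) (hf : ∀ x y, ‖f x y‖ ≤ ‖x‖ * ‖y‖) :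
    Completion E →SL[σ] Completion E →SL[τ] F :=
  ContinuousLinearMap.fromCompletion <| LinearMap.mkContinuous
    { toFun := fun x => ((f x).mkContinuous ‖x‖ (hf x)).fromCompletion
      map_add' := fun x x' => by
        ext y
        induction y using Completion.induction_on with
        | hp => exact isClosed_eq (by fun_prop) (by fun_prop)
        | ih y => simp
      map_smul' := fun c x => by
        ext y
        induction y using Completion.induction_on with
        | hp => exact isClosed_eq (by fun_prop) (by fun_prop)
        | ih y => simp } 1 fun x => by
    rw [one_mul]
    refine ContinuousLinearMap.opNorm_le_bound _ (norm_nonneg _) fun y => ?_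
    induction y using Completion.induction_on with
    | hp => exact isClosed_le (by fun_prop) (by fun_prop)
    | ih y => simpa using hf x y

@[simp]
theorem extend₂_coe (f : E →ₛₗ[σ] E →ₛₗ[τ] F) (hf : ∀ x y, ‖f x y‖ ≤ ‖x‖ * ‖y‖) (x y : E) :
    extend₂ f hf (x : Completion E) (y : Completion E) = f x y := by
  simp [extend₂]

variable {V : Type*} [SeminormedAddCommGroup V] [NormedSpace ℂ V]

/-- The extension to the completion of a bounded operator. -/
noncomputable def extendOp (f : E →ₗ[ℂ] E) (c : ℝ) (hf : ∀ x, ‖f x‖ ≤ c * ‖x‖) :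
    Completion E →L[ℂ] Completion E :=
  (f.mkContinuous c hf).completion

@[simp]
theorem extendOp_coe (f : E →ₗ[ℂ] E) (c : ℝ) (hf : ∀ x, ‖f x‖ ≤ c * ‖x‖) (x : E) :
    extendOp f c hf (x : Completion E) = (f x : E) := by
  simp [extendOp]

/-- The extension to the completion of a bounded bilinear action. -/
noncomputable def extendAct (f : V →ₗ[ℂ] E →ₗ[ℂ] E)
    (hf : ∀ a x, ‖f a x‖ ≤ ‖a‖ * ‖x‖) : V →L[ℂ] Completion E →L[ℂ] Completion E :=
  LinearMap.mkContinuous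
    { toFun := fun a => extendOp (f a) ‖a‖ (hf a)
      map_add' := fun a a' => by
        ext y
        induction y using Completion.induction_on with
        | hp => exact isClosed_eq (by fun_prop) (by fun_prop)
        | ih y => simp [Completion.coe_add]
      map_smul' := fun c x => by
        ext y
        induction y using Completion.induction_on with
        | hp =>
          exact isClosed_eq (ContinuousLinearMap.continuous _) (ContinuousLinearMap.continuous _)
        | ih y =>
          rw [extendOp_coe, map_smul, LinearMap.smul_apply, Completion.coe_smul, RingHom.id_apply,
            smul_apply, extendOp_coe] } 1 fun a => by
    rw [one_mul]
    refine ContinuousLinearMap.opNorm_le_bound _ (norm_nonneg _) fun y => ?_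
    induction y using Completion.induction_on with
    | hp => exact isClosed_le (by fun_prop) (by fun_prop)
    | ih y => simpa using hf a y

@[simp]
theorem extendAct_coe (f : V →ₗ[ℂ] E →ₗ[ℂ] E)
    (hf : ∀ a x, ‖f a x‖ ≤ ‖a‖ * ‖x‖) (a : V) (x : E) :
    extendAct f hf a (x : Completion E) = (f a x : E) := by
  simp [extendAct]

end Extend

namespace PreBimodule

variable (P : PreBimodule A B)

/-- The left action on the completion. -/
noncomputable def lactC : A →L[ℂ] P.Compl →L[ℂ] P.Compl := extendAct P.lact P.norm_lact_le

/-- The right action on the completion. -/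
noncomputable def ractC : B →L[ℂ] P.Compl →L[ℂ] P.Compl := extendAct P.ract P.norm_ract_le

/-- The left inner product on the completion. -/
noncomputable def linnerC : P.Compl →L[ℂ] P.Compl →L⋆[ℂ] A := extend₂ P.linner P.norm_linner_le

/-- The right inner product on the completion. -/
noncomputable def rinnerC : P.Compl →L⋆[ℂ] P.Compl →L[ℂ] B := extend₂ P.rinner P.norm_rinner_le

@[fun_prop]
theorem continuous_linnerC {X : Type*} [TopologicalSpace X] {f g : X → P.Compl}
    (hf : Continuous f) (hg : Continuous g) : Continuous fun x => P.linnerC (f x) (g x) := by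
  have h : Continuous fun x => P.linnerC.flip (g x) (f x) := by fun_prop
  exact h

@[simp] theorem lactC_coe (a : A) (x : P.carrier) :
    P.lactC a (x : P.Compl) = (P.lact a x : P.carrier) := extendAct_coe ..
@[simp] theorem ractC_coe (b : B) (x : P.carrier) :
    P.ractC b (x : P.Compl) = (P.ract b x : P.carrier) := extendAct_coe ..
@[simp] theorem linnerC_coe (x y : P.carrier) :
    P.linnerC (x : P.Compl) (y : P.Compl) = P.linner x y := extend₂_coe ..
@[simp] theorem rinnerC_coe (x y : P.carrier) :
    P.rinnerC (x : P.Compl) (y : P.Compl) = P.rinner x y := extend₂_coe ..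

theorem norm_eq_rinnerC (x : P.Compl) : ‖x‖ = √‖P.rinnerC x x‖ := by
  induction x using Completion.induction_on with
  | hp => exact isClosed_eq (by fun_prop) (by fun_prop)
  | ih x => simp [norm_def]

theorem norm_eq_linnerC (x : P.Compl) : ‖x‖ = √‖P.linnerC x x‖ := by
  induction x using Completion.induction_on with
  | hp => exact isClosed_eq (by fun_prop) (by fun_prop)
  | ih x => simp [norm_def']

theorem coe_eq_of_rinner {x y : P.carrier} (h : ∀ w, P.rinner w x = P.rinner w y) :
    (x : P.Compl) = y := by
  rw [← sub_eq_zero, ← Completion.coe_sub, ← norm_eq_zero, Completion.norm_coe, norm_def, map_sub,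
    h, sub_self]
  simp

theorem star_linnerC (x y : P.Compl) : star (P.linnerC x y) = P.linnerC y x := by
  induction x, y using Completion.induction_on₂ with
  | hp => exact isClosed_eq (by fun_prop) (by fun_prop)
  | ih x y => simp [P.star_linner]

theorem star_rinnerC (x y : P.Compl) : star (P.rinnerC x y) = P.rinnerC y x := by
  induction x, y using Completion.induction_on₂ with
  | hp => exact isClosed_eq (by fun_prop) (by fun_prop)
  | ih x y => simp [P.star_rinner]

theorem linnerC_lactC (a : A) (x y : P.Compl) :
    P.linnerC (P.lactC a x) y = a * P.linnerC x y := by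
  induction x, y using Completion.induction_on₂ with
  | hp => exact isClosed_eq (by fun_prop) (by fun_prop)
  | ih x y => simp [P.linner_lact]

theorem rinnerC_ractC (b : B) (x y : P.Compl) :
    P.rinnerC x (P.ractC b y) = P.rinnerC x y * b := by
  induction x, y using Completion.induction_on₂ with
  | hp => exact isClosed_eq (by fun_prop) (by fun_prop)
  | ih x y => simp [P.rinner_ract]

theorem mem_closure_lactC (x : P.Compl) : x ∈ closure (Set.range fun a => P.lactC a x) := by
  refine mem_closure_range_left _ x (P.linnerC x x) fun a => ?_
  rw [norm_eq_linnerC, Real.sq_sqrt (norm_nonneg _)]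
  have e : P.linnerC (x - P.lactC a x) (x - P.lactC a x) =
      (P.linnerC x x - a * P.linnerC x x) - (P.linnerC x x - a * P.linnerC x x) * star a := by
    have h1 : P.linnerC x (P.lactC a x) = P.linnerC x x * star a := by
      rw [← star_linnerC, linnerC_lactC, star_mul, star_linnerC]
    simp only [map_sub, sub_apply, linnerC_lactC, h1, sub_mul, mul_assoc]
  rw [e, mul_add, mul_one]
  refine (norm_sub_le _ _).trans ?_
  gcongr
  exact (norm_mul_le _ _).trans (by rw [norm_star])

theorem mem_closure_ractC (x : P.Compl) : x ∈ closure (Set.range fun b => P.ractC b x) := by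
  refine mem_closure_range_right _ x (P.rinnerC x x) fun a => ?_
  rw [norm_eq_rinnerC, Real.sq_sqrt (norm_nonneg _)]
  have e : P.rinnerC (x - P.ractC a x) (x - P.ractC a x) =
      (P.rinnerC x x - P.rinnerC x x * a) - star a * (P.rinnerC x x - P.rinnerC x x * a) := by
    have h1 : P.rinnerC (P.ractC a x) x = star a * P.rinnerC x x := by
      rw [← star_rinnerC, rinnerC_ractC, star_mul, star_rinnerC]
    simp only [map_sub, sub_apply, rinnerC_ractC, h1, mul_sub, mul_assoc]
    abel
  rw [e, mul_add, mul_one, mul_comm _ ‖a‖]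
  refine (norm_sub_le _ _).trans ?_
  gcongr
  exact (norm_mul_le _ _).trans (by rw [norm_star])

/-- The Hilbert bimodule obtained from a pre-Hilbert bimodule by separation and completion. -/
noncomputable def completion : HilbertBimodule A B where
  carrier := P.Compl
  lact := P.lactC.toLinearMap₁₂
  ract := P.ractC.toLinearMap₁₂
  lact_mul a a' x := by
    change P.lactC (a * a') x = P.lactC a (P.lactC a' x)
    induction x using Completion.induction_on with
    | hp => exact isClosed_eq (by fun_prop) (by fun_prop)
    | ih x => simp [P.lact_mul]
  ract_mul b b' x := by
    change P.ractC (b * b') x = P.ractC b' (P.ractC b x)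
    induction x using Completion.induction_on with
    | hp => exact isClosed_eq (by fun_prop) (by fun_prop)
    | ih x => simp [P.ract_mul]
  lact_ract a b x := by
    change P.ractC b (P.lactC a x) = P.lactC a (P.ractC b x)
    induction x using Completion.induction_on with
    | hp => exact isClosed_eq (by fun_prop) (by fun_prop)
    | ih x => simp [P.lact_ract]
  lact_nondegenerate x := closure_mono
    (by rintro _ ⟨a, rfl⟩; exact Submodule.subset_span ⟨a, x, rfl⟩) (P.mem_closure_lactC x)
  ract_nondegenerate x := closure_mono
    (by rintro _ ⟨a, rfl⟩; exact Submodule.subset_span ⟨a, x, rfl⟩) (P.mem_closure_ractC x)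
  linner := P.linnerC.toLinearMap₁₂
  rinner := P.rinnerC.toLinearMap₁₂
  star_linner := P.star_linnerC
  star_rinner := P.star_rinnerC
  linner_lact := P.linnerC_lactC
  rinner_ract := P.rinnerC_ractC
  linner_self_nonneg x := by
    change 0 ≤ P.linnerC x x
    induction x using Completion.induction_on with
    | hp => exact CStarAlgebra.isClosed_nonneg.preimage (by fun_prop)
    | ih x => simpa using P.linner_self_nonneg x
  rinner_self_nonneg x := by
    change 0 ≤ P.rinnerC x x
    induction x using Completion.induction_on with
    | hp => exact CStarAlgebra.isClosed_nonneg.preimage (by fun_prop)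
    | ih x => simpa using P.rinner_self_nonneg x
  linner_definite x hx := by
    change P.linnerC x x = 0 at hx
    rw [← norm_eq_zero, norm_eq_linnerC, hx]
    simp
  rinner_definite x hx := by
    change P.rinnerC x x = 0 at hx
    rw [← norm_eq_zero, norm_eq_rinnerC, hx]
    simp
  rinner_lact a x y := by
    change P.rinnerC (P.lactC a x) y = P.rinnerC x (P.lactC (star a) y)
    induction x, y using Completion.induction_on₂ with
    | hp => exact isClosed_eq (by fun_prop) (by fun_prop)
    | ih x y => simp [P.rinner_lact]
  linner_ract b x y := by
    change P.linnerC (P.ractC b x) y = P.linnerC x (P.ractC (star b) y)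
    induction x, y using Completion.induction_on₂ with
    | hp => exact isClosed_eq (by fun_prop) (by fun_prop)
    | ih x y => simp [P.linner_ract]
  norm_equiv_linner := ⟨1, 1, one_pos, one_pos, fun x => by
    rw [one_mul]; exact ⟨(P.norm_eq_linnerC x).le, (P.norm_eq_linnerC x).ge⟩⟩
  norm_equiv_rinner := ⟨1, 1, one_pos, one_pos, fun x => by
    rw [one_mul]; exact ⟨(P.norm_eq_rinnerC x).le, (P.norm_eq_rinnerC x).ge⟩⟩
  linner_lact_eq x y z := by
    change P.lactC (P.linnerC x y) z = P.ractC (P.rinnerC y z) x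
    induction x, y, z using Completion.induction_on₃ with
    | hp => exact isClosed_eq (by fun_prop) (by fun_prop)
    | ih x y z =>
      simp only [linnerC_coe, rinnerC_coe, lactC_coe, ractC_coe]
      exact P.coe_eq_of_rinner fun w => P.rinner_assoc w x y z

end PreBimodule

/-- An isomorphism of Hilbert bimodules: a bicontinuous linear bijection preserving both actions
and both inner products. -/
structure HilbertBimodule.Iso (M N : HilbertBimodule A B) extends
    M.carrier ≃L[ℂ] N.carrier where
  map_lact : ∀ a m, toFun (M.lact a m) = N.lact a (toFun m)
  map_ract : ∀ b m, toFun (M.ract b m) = N.ract b (toFun m)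
  map_linner : ∀ m n, N.linner (toFun m) (toFun n) = M.linner m n
  map_rinner : ∀ m n, N.rinner (toFun m) (toFun n) = M.rinner m n

namespace HilbertBimodule

/-- Two Hilbert bimodules are isomorphic. -/
def IsIso (M N : HilbertBimodule A B) : Prop := Nonempty (Iso M N)

theorem isIso_equivalence : Equivalence (IsIso (A := A) (B := B)) where
  refl M := ⟨⟨ContinuousLinearEquiv.refl ℂ _, fun _ _ => rfl, fun _ _ => rfl, fun _ _ => rfl,
    fun _ _ => rfl⟩⟩
  symm := by
    rintro M N ⟨f⟩
    have hs : ∀ x, f.toFun (f.toContinuousLinearEquiv.symm x) = x :=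
      f.toContinuousLinearEquiv.apply_symm_apply
    have hs' : ∀ x, f.toContinuousLinearEquiv.symm (f.toFun x) = x :=
      f.toContinuousLinearEquiv.symm_apply_apply
    refine ⟨⟨f.toContinuousLinearEquiv.symm, fun a m => ?_, fun a m => ?_, fun m n => ?_,
      fun m n => ?_⟩⟩
    · change f.toContinuousLinearEquiv.symm _ = M.lact a (f.toContinuousLinearEquiv.symm m)
      rw [← hs' (M.lact a _), f.map_lact, hs]
    · change f.toContinuousLinearEquiv.symm _ = M.ract a (f.toContinuousLinearEquiv.symm m)
      rw [← hs' (M.ract a _), f.map_ract, hs]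
    · change M.linner (f.toContinuousLinearEquiv.symm m) (f.toContinuousLinearEquiv.symm n) = _
      rw [← f.map_linner, hs, hs]
    · change M.rinner (f.toContinuousLinearEquiv.symm m) (f.toContinuousLinearEquiv.symm n) = _
      rw [← f.map_rinner, hs, hs]
  trans := by
    rintro M N K ⟨f⟩ ⟨g⟩
    refine ⟨⟨f.toContinuousLinearEquiv.trans g.toContinuousLinearEquiv, fun a m => ?_,
      fun a m => ?_, fun m n => ?_, fun m n => ?_⟩⟩
    · exact (congrArg g.toFun (f.map_lact a m)).trans (g.map_lact a _)
    · exact (congrArg g.toFun (f.map_ract a m)).trans (g.map_ract a _)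
    · exact (g.map_linner _ _).trans (f.map_linner m n)
    · exact (g.map_rinner _ _).trans (f.map_rinner m n)

end HilbertBimodule

theorem PreBimodule.completion_isIso {P Q : PreBimodule A B} (φ : P.carrier ≃ₗ[ℂ] Q.carrier)
    (hl : ∀ a m, φ (P.lact a m) = Q.lact a (φ m)) (hr : ∀ b m, φ (P.ract b m) = Q.ract b (φ m))
    (hli : ∀ m n, Q.linner (φ m) (φ n) = P.linner m n)
    (hri : ∀ m n, Q.rinner (φ m) (φ n) = P.rinner m n) : P.completion.IsIso Q.completion := by
  have hn : ∀ x, ‖φ x‖ = ‖x‖ := fun x => by rw [norm_def, norm_def, hri]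
  let ψ : P.carrier →L[ℂ] Q.carrier := φ.toLinearMap.mkContinuous 1 fun x => by simp [hn]
  let ψ' : Q.carrier →L[ℂ] P.carrier := φ.symm.toLinearMap.mkContinuous 1 fun x => by
    rw [← hn]; simp
  have hψ : ∀ x : P.carrier, ψ.completion (x : P.Compl) = (φ x : Q.carrier) := fun x => by simp [ψ]
  have hψ' : ∀ x : Q.carrier, ψ'.completion (x : Q.Compl) = (φ.symm x : P.carrier) :=
    fun x => by simp [ψ']
  let e : P.Compl ≃L[ℂ] Q.Compl := ContinuousLinearEquiv.equivOfInverse ψ.completion ψ'.completion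
    (fun x => by
      induction x using Completion.induction_on with
      | hp => exact isClosed_eq (by fun_prop) (by fun_prop)
      | ih x => rw [hψ, hψ', φ.symm_apply_apply])
    (fun x => by
      induction x using Completion.induction_on with
      | hp => exact isClosed_eq (by fun_prop) (by fun_prop)
      | ih x => rw [hψ', hψ, φ.apply_symm_apply])
  refine ⟨⟨e, fun a x => ?_, fun a x => ?_, fun x y => ?_, fun x y => ?_⟩⟩
  · change ψ.completion (P.lactC a x) = Q.lactC a (ψ.completion x)
    induction x using Completion.induction_on with
    | hp => exact isClosed_eq (by fun_prop) (by fun_prop)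
    | ih x => rw [lactC_coe, hψ, hψ, lactC_coe, hl]
  · change ψ.completion (P.ractC a x) = Q.ractC a (ψ.completion x)
    induction x using Completion.induction_on with
    | hp => exact isClosed_eq (by fun_prop) (by fun_prop)
    | ih x => rw [ractC_coe, hψ, hψ, ractC_coe, hr]
  · change Q.linnerC (ψ.completion x) (ψ.completion y) = P.linnerC x y
    induction x, y using Completion.induction_on₂ with
    | hp => exact isClosed_eq (by fun_prop) (by fun_prop)
    | ih x y => rw [hψ, hψ, linnerC_coe, linnerC_coe, hli]
  · change Q.rinnerC (ψ.completion x) (ψ.completion y) = P.rinnerC x y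
    induction x, y using Completion.induction_on₂ with
    | hp => exact isClosed_eq (by fun_prop) (by fun_prop)
    | ih x y => rw [hψ, hψ, rinnerC_coe, rinnerC_coe, hri]


namespace HilbertBimodule

section Basic

variable (M : HilbertBimodule A B)

theorem rinner_ract_left (b : B) (m n : M.carrier) :
    M.rinner (M.ract b m) n = star b * M.rinner m n := by
  rw [← M.star_rinner, M.rinner_ract, star_mul, M.star_rinner]

theorem linner_lact_right (a : A) (m n : M.carrier) :
    M.linner m (M.lact a n) = M.linner m n * star a := by
  rw [← M.star_linner, M.linner_lact, star_mul, M.star_linner]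

end Basic

section Tensor

variable (M : HilbertBimodule A B) (N : HilbertBimodule B C)

/-- The right inner product `⟨m ⊗ n, m' ⊗ n'⟩ = ⟨n, ⟨m, m'⟩ n'⟩` on the algebraic tensor
product. -/
noncomputable def tensorRinner :
    M.carrier ⊗[ℂ] N.carrier →ₗ⋆[ℂ] M.carrier ⊗[ℂ] N.carrier →ₗ[ℂ] C :=
  TensorProduct.lift <| LinearMap.mk₂'ₛₗ (starRingEnd ℂ) (starRingEnd ℂ)
    (fun m n => TensorProduct.lift <| LinearMap.mk₂ ℂ
      (fun m' n' => N.rinner n (N.lact (M.rinner m m') n'))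
      (by intros; simp) (by intros; simp) (by intros; simp) (by intros; simp))
    (by intros; apply TensorProduct.ext'; intros; simp)
    (by intros; apply TensorProduct.ext'; intros; simp)
    (by intros; apply TensorProduct.ext'; intros; simp)
    (by intros; apply TensorProduct.ext'; intros; simp)

@[simp]
theorem tensorRinner_tmul (m m' : M.carrier) (n n' : N.carrier) :
    tensorRinner M N (m ⊗ₜ n) (m' ⊗ₜ n') = N.rinner n (N.lact (M.rinner m m') n') := rfl

/-- The conjugate linear map `m' ⊗ n' ↦ ⟨m ⟨n, n'⟩, m'⟩`. -/
noncomputable def tensorLinnerAux (m : M.carrier) (n : N.carrier) :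
    M.carrier ⊗[ℂ] N.carrier →ₗ⋆[ℂ] A :=
  TensorProduct.lift <| LinearMap.mk₂'ₛₗ (starRingEnd ℂ) (starRingEnd ℂ)
    (fun m' n' => M.linner (M.ract (N.linner n n') m) m')
    (by intros; simp) (by intros; simp) (by intros; simp) (by intros; simp)

@[simp]
theorem tensorLinnerAux_tmul (m m' : M.carrier) (n n' : N.carrier) :
    tensorLinnerAux M N m n (m' ⊗ₜ n') = M.linner (M.ract (N.linner n n') m) m' := rfl

theorem conj_ext {E F : Type*} [AddCommGroup E] [Module ℂ E] [AddCommGroup F] [Module ℂ F]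
    {V : Type*} [AddCommGroup V] [Module ℂ V] {f g : E ⊗[ℂ] F →ₗ⋆[ℂ] V}
    (h : ∀ x y, f (x ⊗ₜ y) = g (x ⊗ₜ y)) : f = g := by
  refine LinearMap.ext fun x => ?_
  induction x using TensorProduct.induction_on with
  | zero => rw [map_zero, map_zero]
  | add x x' hx hx' => rw [map_add, map_add, hx, hx']
  | tmul x y => exact h x y

/-- The left inner product `⟨m ⊗ n, m' ⊗ n'⟩ = ⟨m ⟨n, n'⟩, m'⟩` on the algebraic tensor
product. -/
noncomputable def tensorLinner :
    M.carrier ⊗[ℂ] N.carrier →ₗ[ℂ] M.carrier ⊗[ℂ] N.carrier →ₗ⋆[ℂ] A :=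
  TensorProduct.lift <| LinearMap.mk₂ ℂ (tensorLinnerAux M N)
    (by intros; apply conj_ext; intros; simp)
    (by intros; apply conj_ext; intros; simp)
    (by intros; apply conj_ext; intros; simp)
    (by intros; apply conj_ext; intros; simp)

@[simp]
theorem tensorLinner_tmul (m m' : M.carrier) (n n' : N.carrier) :
    tensorLinner M N (m ⊗ₜ n) (m' ⊗ₜ n') = M.linner (M.ract (N.linner n n') m) m' := rfl

theorem tensorRinner_self_nonneg (x : M.carrier ⊗[ℂ] N.carrier) : 0 ≤ tensorRinner M N x x := by
  obtain ⟨S, rfl⟩ := TensorProduct.exists_finset x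
  rw [← Finset.sum_coe_sort]
  obtain ⟨s, hs⟩ := exists_gram (ι := S) (fun i j => M.rinner i.1.1 j.1.1)
    (fun i j => M.star_rinner _ _) (fun b => by
      convert M.rinner_self_nonneg (∑ i, M.ract (b i) i.1.1) using 1
      simp only [map_sum, LinearMap.sum_apply, rinner_ract_left, M.rinner_ract, mul_assoc]
      rw [Finset.sum_comm])
  convert Finset.sum_nonneg (fun k (_ : k ∈ Finset.univ) =>
    N.rinner_self_nonneg (∑ j, N.lact (s k j) j.1.2)) using 1
  simp only [map_sum, LinearMap.sum_apply, tensorRinner_tmul, hs, N.lact_mul, ← N.rinner_lact]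
  rw [Finset.sum_comm_cycle]

theorem tensorLinner_self_nonneg (x : M.carrier ⊗[ℂ] N.carrier) : 0 ≤ tensorLinner M N x x := by
  obtain ⟨S, rfl⟩ := TensorProduct.exists_finset x
  rw [← Finset.sum_coe_sort]
  obtain ⟨s, hs⟩ := exists_gram (ι := S) (fun i j => N.linner i.1.2 j.1.2)
    (fun i j => N.star_linner _ _) (fun b => by
      convert N.linner_self_nonneg (∑ i, N.lact (star (b i)) i.1.2) using 1
      simp only [map_sum, LinearMap.sum_apply, N.linner_lact, linner_lact_right, star_star,
        mul_assoc]
      rw [Finset.sum_comm])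
  convert Finset.sum_nonneg (fun k (_ : k ∈ Finset.univ) =>
    M.linner_self_nonneg (∑ j, M.ract (star (s k j)) j.1.1)) using 1
  simp only [map_sum, LinearMap.sum_apply, tensorLinner_tmul, hs, M.ract_mul, M.linner_ract]
  rw [Finset.sum_comm_cycle]

/-- The algebraic tensor product `M ⊗ N` with its semi-inner products. The elements
`m b ⊗ n - m ⊗ b n` are in the kernel of the seminorm. -/
noncomputable def tensorPre : PreBimodule A C where
  carrier := M.carrier ⊗[ℂ] N.carrier
  lact := LinearMap.rTensorHom N.carrier ∘ₗ M.lact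
  ract := LinearMap.lTensorHom M.carrier ∘ₗ N.ract
  lact_mul a a' x := by
    induction x using TensorProduct.induction_on <;> simp_all [M.lact_mul]
  ract_mul b b' x := by
    induction x using TensorProduct.induction_on <;> simp_all [N.ract_mul]
  lact_ract a b x := by
    induction x using TensorProduct.induction_on <;> simp_all
  linner := tensorLinner M N
  rinner := tensorRinner M N
  star_linner x y := by
    induction x using TensorProduct.induction_on with
    | zero => simp
    | add x x' hx hx' => simp [hx, hx']
    | tmul m n =>
      induction y using TensorProduct.induction_on with
      | zero => simp
      | add x x' hx hx' => simp [hx, hx']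
      | tmul m' n' => simp [M.star_linner, M.linner_ract, N.star_linner]
  star_rinner x y := by
    induction x using TensorProduct.induction_on with
    | zero => simp
    | add x x' hx hx' => simp [hx, hx']
    | tmul m n =>
      induction y using TensorProduct.induction_on with
      | zero => simp
      | add x x' hx hx' => simp [hx, hx']
      | tmul m' n' => simp [N.star_rinner, N.rinner_lact, M.star_rinner]
  linner_lact a x y := by
    induction x using TensorProduct.induction_on with
    | zero => simp
    | add x x' hx hx' => simp_all [mul_add]
    | tmul m n =>
      induction y using TensorProduct.induction_on with
      | zero => simp
      | add x x' hx hx' => simp_all [mul_add]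
      | tmul m' n' => simp [M.linner_lact, M.lact_ract]
  rinner_ract b x y := by
    induction x using TensorProduct.induction_on with
    | zero => simp
    | add x x' hx hx' => simp_all [add_mul]
    | tmul m n =>
      induction y using TensorProduct.induction_on with
      | zero => simp
      | add x x' hx hx' => simp_all [add_mul]
      | tmul m' n' => simp [N.rinner_ract, ← N.lact_ract]
  linner_self_nonneg := tensorLinner_self_nonneg M N
  rinner_self_nonneg := tensorRinner_self_nonneg M N
  rinner_lact a x y := by
    induction x using TensorProduct.induction_on with
    | zero => simp
    | add x x' hx hx' => simp_all
    | tmul m n =>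
      induction y using TensorProduct.induction_on with
      | zero => simp
      | add x x' hx hx' => simp_all
      | tmul m' n' => simp [M.rinner_lact]
  linner_ract b x y := by
    induction x using TensorProduct.induction_on with
    | zero => simp
    | add x x' hx hx' => simp_all
    | tmul m n =>
      induction y using TensorProduct.induction_on with
      | zero => simp
      | add x x' hx hx' => simp_all
      | tmul m' n' => simp [N.linner_ract]
  rinner_assoc w x y z := by
    induction x using TensorProduct.induction_on with
    | zero => simp
    | add x x' hx hx' => simp_all
    | tmul m n =>
      induction y using TensorProduct.induction_on with
      | zero => simp
      | add x x' hx hx' => simp_all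
      | tmul m' n' =>
        induction z using TensorProduct.induction_on with
        | zero => simp
        | add x x' hx hx' => simp_all
        | tmul m'' n'' =>
          induction w using TensorProduct.induction_on with
          | zero => simp
          | add x x' hx hx' => simp_all
          | tmul p q =>
            simp [M.linner_lact_eq, ← N.linner_lact_eq, M.rinner_ract, N.lact_mul]
  linner_assoc w x y z := by
    induction x using TensorProduct.induction_on with
    | zero => simp
    | add x x' hx hx' => simp_all
    | tmul m n =>
      induction y using TensorProduct.induction_on with
      | zero => simp
      | add x x' hx hx' => simp_all
      | tmul m' n' =>
        induction z using TensorProduct.induction_on with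
        | zero => simp
        | add x x' hx hx' => simp_all
        | tmul m'' n'' =>
          induction w using TensorProduct.induction_on with
          | zero => simp
          | add x x' hx hx' => simp_all
          | tmul p q =>
            simp [M.linner_lact_eq, ← N.linner_lact_eq, N.linner_lact, M.ract_mul]

/-- The interior tensor product `M ⊗_B N`: the separated completion of the algebraic tensor product
with respect to the inner products `⟨m ⊗ n, m' ⊗ n'⟩ = ⟨m ⟨n, n'⟩, m'⟩` (left) and
`⟨m ⊗ n, m' ⊗ n'⟩ = ⟨n, ⟨m, m'⟩ n'⟩` (right). -/
noncomputable def tensor : HilbertBimodule A C := (tensorPre M N).completion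

end Tensor

theorem tensor_congr {M M' : HilbertBimodule A B} {N N' : HilbertBimodule B C}
    (hM : M.IsIso M') (hN : N.IsIso N') : (M.tensor N).IsIso (M'.tensor N') := by
  obtain ⟨f⟩ := hM
  obtain ⟨g⟩ := hN
  let φ : M.carrier ⊗[ℂ] N.carrier ≃ₗ[ℂ] M'.carrier ⊗[ℂ] N'.carrier :=
    TensorProduct.congr f.toLinearEquiv g.toLinearEquiv
  have hφ : ∀ m n, φ (m ⊗ₜ n) = f.toFun m ⊗ₜ[ℂ] g.toFun n := fun _ _ => rfl
  have h1 : ∀ a x, φ ((M.lact a).rTensor _ x) = (M'.lact a).rTensor _ (φ x) := fun a x => by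
    induction x using TensorProduct.induction_on with
    | zero => simp
    | add x x' hx hx' => simp only [map_add, hx, hx']
    | tmul m n => simp only [LinearMap.rTensor_tmul, hφ, f.map_lact]
  have h2 : ∀ b x, φ ((N.ract b).lTensor _ x) = (N'.ract b).lTensor _ (φ x) := fun a x => by
    induction x using TensorProduct.induction_on with
    | zero => simp
    | add x x' hx hx' => simp only [map_add, hx, hx']
    | tmul m n => simp only [LinearMap.lTensor_tmul, hφ, g.map_ract]
  have h3 : ∀ x y, tensorLinner M' N' (φ x) (φ y) = tensorLinner M N x y := fun x y => by
    induction x using TensorProduct.induction_on with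
    | zero => simp
    | add x x' hx hx' => simp only [map_add, LinearMap.add_apply, hx, hx']
    | tmul m n =>
      induction y using TensorProduct.induction_on with
      | zero => simp
      | add x x' hx hx' => simp only [map_add, hx, hx']
      | tmul m' n' =>
        rw [hφ, hφ, tensorLinner_tmul, tensorLinner_tmul, g.map_linner, ← f.map_ract, f.map_linner]
  have h4 : ∀ x y, tensorRinner M' N' (φ x) (φ y) = tensorRinner M N x y := fun x y => by
    induction x using TensorProduct.induction_on with
    | zero => simp
    | add x x' hx hx' => simp only [map_add, LinearMap.add_apply, hx, hx']
    | tmul m n =>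
      induction y using TensorProduct.induction_on with
      | zero => simp
      | add x x' hx hx' => simp only [map_add, hx, hx']
      | tmul m' n' =>
        rw [hφ, hφ, tensorRinner_tmul, tensorRinner_tmul, f.map_rinner, ← g.map_lact, g.map_rinner]
  exact PreBimodule.completion_isIso (P := tensorPre M N) (Q := tensorPre M' N') φ h1 h2 h3 h4

end HilbertBimodule

/-- A closed two-sided ideal of a C⋆-algebra, as a subspace. -/
def idealSubmodule (J : TwoSidedIdeal A) (hJ : IsClosed (J : Set A)) : Submodule ℂ A where
  carrier := J
  add_mem' := J.add_mem
  zero_mem' := J.zero_mem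
  smul_mem' c x hx := by
    have hl := CStarAlgebra.increasingApproximateUnit A
    have h : Tendsto (fun u : A => (c • u) * x) (CStarAlgebra.approximateUnit A) (𝓝 (c • x)) := by
      simp_rw [smul_mul_assoc]
      exact (hl.tendsto_mul_right x).const_smul c
    exact hJ.mem_of_tendsto h (Eventually.of_forall fun u => J.mul_mem_left _ _ hx)

/-- A closed two-sided ideal `J` of `A` as a Hilbert bimodule over `A`, with the multiplication of
`A` as actions and the inner products `x y⋆` (left) and `x⋆ y` (right). -/
noncomputable def idealBimodule (J : TwoSidedIdeal A) (hJ : IsClosed (J : Set A)) :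
    HilbertBimodule A A where
  carrier := idealSubmodule J hJ
  completeSpace := IsClosed.completeSpace_coe (s := (J : Set A)) (hs := hJ)
  lact := LinearMap.mk₂ ℂ (fun a x => ⟨a * x.1, J.mul_mem_left _ _ x.2⟩)
    (fun a a' x => Subtype.ext (add_mul a a' x.1)) (fun c a x => Subtype.ext (smul_mul_assoc c a x.1))
    (fun a x x' => Subtype.ext (mul_add a x.1 x'.1)) (fun c a x => Subtype.ext (mul_smul_comm c a x.1))
  ract := LinearMap.mk₂ ℂ (fun a x => ⟨x.1 * a, J.mul_mem_right _ _ x.2⟩)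
    (fun a a' x => Subtype.ext (mul_add x.1 a a')) (fun c a x => Subtype.ext (mul_smul_comm c x.1 a))
    (fun a x x' => Subtype.ext (add_mul x.1 x'.1 a)) (fun c a x => Subtype.ext (smul_mul_assoc c x.1 a))
  lact_mul a a' x := Subtype.ext (mul_assoc a a' x.1)
  ract_mul a a' x := Subtype.ext (mul_assoc x.1 a a').symm
  lact_ract a b x := Subtype.ext (mul_assoc a x.1 b)
  lact_nondegenerate x := by
    refine closure_mono ?_ (mem_closure_range_left
      (fun a : A => (⟨a * x.1, J.mul_mem_left _ _ x.2⟩ : idealSubmodule J hJ)) x (x.1 * star x.1)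
      fun a => ?_)
    · rintro _ ⟨a, rfl⟩
      exact Submodule.subset_span ⟨a, x, rfl⟩
    · change ‖x.1 - a * x.1‖ ^ 2 ≤ _
      rw [sq, ← CStarRing.norm_self_mul_star]
      have e : (x.1 - a * x.1) * star (x.1 - a * x.1) = (x.1 * star x.1 - a * (x.1 * star x.1)) -
          (x.1 * star x.1 - a * (x.1 * star x.1)) * star a := by
        simp only [star_sub, star_mul, sub_mul, mul_sub, mul_assoc]
      rw [e, mul_add, mul_one]
      refine (norm_sub_le _ _).trans ?_
      gcongr
      exact (norm_mul_le _ _).trans (by rw [norm_star])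
  ract_nondegenerate x := by
    refine closure_mono ?_ (mem_closure_range_right
      (fun a : A => (⟨x.1 * a, J.mul_mem_right _ _ x.2⟩ : idealSubmodule J hJ)) x (star x.1 * x.1)
      fun a => ?_)
    · rintro _ ⟨a, rfl⟩
      exact Submodule.subset_span ⟨a, x, rfl⟩
    · change ‖x.1 - x.1 * a‖ ^ 2 ≤ _
      rw [sq, ← CStarRing.norm_star_mul_self]
      have e : star (x.1 - x.1 * a) * (x.1 - x.1 * a) = (star x.1 * x.1 - star x.1 * x.1 * a) -
          star a * (star x.1 * x.1 - star x.1 * x.1 * a) := by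
        simp only [star_sub, star_mul, sub_mul, mul_sub, mul_assoc]
        abel
      rw [e, mul_add, mul_one, mul_comm _ ‖a‖]
      refine (norm_sub_le _ _).trans ?_
      gcongr
      exact (norm_mul_le _ _).trans (by rw [norm_star])
  linner := LinearMap.mk₂'ₛₗ (RingHom.id ℂ) (starRingEnd ℂ) (fun x y => x.1 * star y.1)
    (by intros; simp [add_mul]) (by intros; simp [smul_mul_assoc])
    (by intros; simp [mul_add]) (by intros; simp [mul_smul_comm])
  rinner := LinearMap.mk₂'ₛₗ (starRingEnd ℂ) (RingHom.id ℂ) (fun x y => star x.1 * y.1)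
    (by intros; simp [add_mul]) (by intros; simp [smul_mul_assoc])
    (by intros; simp [mul_add]) (by intros; simp [mul_smul_comm])
  star_linner x y := by simp
  star_rinner x y := by simp
  linner_lact a x y := mul_assoc a x.1 (star y.1)
  rinner_ract b x y := (mul_assoc (star x.1) y.1 b).symm
  linner_self_nonneg x := mul_star_self_nonneg x.1
  rinner_self_nonneg x := star_mul_self_nonneg x.1
  linner_definite x hx := Subtype.ext ((CStarRing.mul_star_self_eq_zero_iff x.1).mp hx)
  rinner_definite x hx := Subtype.ext ((CStarRing.star_mul_self_eq_zero_iff x.1).mp hx)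
  rinner_lact a x y := by simp [mul_assoc]
  linner_ract a x y := by simp [mul_assoc]
  norm_equiv_linner := ⟨1, 1, one_pos, one_pos, fun x => by
    have : √‖x.1 * star x.1‖ = ‖x‖ := by
      rw [CStarRing.norm_self_mul_star, Real.sqrt_mul_self (norm_nonneg _)]; rfl
    simp [this]⟩
  norm_equiv_rinner := ⟨1, 1, one_pos, one_pos, fun x => by
    have : √‖star x.1 * x.1‖ = ‖x‖ := by
      rw [CStarRing.norm_star_mul_self, Real.sqrt_mul_self (norm_nonneg _)]; rfl
    simp [this]⟩
  linner_lact_eq x y z := Subtype.ext (mul_assoc x.1 (star y.1) z.1)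

variable (A) in
/-- Isomorphism of Hilbert bimodules over `A` as a setoid. -/
def bimoduleSetoid : Setoid (HilbertBimodule A A) where
  r := HilbertBimodule.IsIso
  iseqv := HilbertBimodule.isIso_equivalence

variable (A) in
/-- The set `S(A)` of isomorphism classes of associative Hilbert bimodules over `A`. -/
def S : Type (u + 1) := Quotient (bimoduleSetoid A)

namespace S

/-- The isomorphism class of a Hilbert bimodule. -/
def mk (M : HilbertBimodule A A) : S A := Quotient.mk (bimoduleSetoid A) M

/-- The multiplication on `S(A)`, induced by the interior tensor product over `A`. -/
noncomputable instance : Mul (S A) where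
  mul := Quotient.map₂ HilbertBimodule.tensor fun _ _ hM _ _ hN =>
    HilbertBimodule.tensor_congr hM hN

theorem mk_eq_mk {M N : HilbertBimodule A A} : mk M = mk N ↔ M.IsIso N := Quotient.eq

theorem mk_mul_mk (M N : HilbertBimodule A A) : mk M * mk N = mk (M.tensor N) := rfl

/-- The class in `S(A)` of a closed two-sided ideal of `A`. -/
noncomputable def ofIdeal (J : {J : TwoSidedIdeal A // IsClosed (J : Set A)}) : S A :=
  mk (idealBimodule J.1 J.2)

end S

/-- A set with a multiplication is an inverse semigroup if the multiplication is associative and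
every element `s` has a unique inverse, i.e. a unique `t` with `s t s = s` and `t s t = t`. -/
def IsInverseSemigroup (T : Type*) [Mul T] : Prop :=
  (∀ r s t : T, r * s * t = r * (s * t)) ∧ ∀ s : T, ∃! t : T, s * t * s = s ∧ t * s * t = t

end CStarBimod

/-!
The main tool is a rigidity principle (`HilbertBimodule.isIso_of_gram`): two Hilbert bimodules are
isomorphic as soon as they contain families of vectors with dense span and with the same Gram
matrices for both inner products. So an isomorphism between completed tensor products is given by
writing down corresponding families and comparing inner products of elementary tensors; that the
actions are respected is automatic.

In this way one gets associativity, `I ⊗ J ≅ I ∩ J` by `a ⊗ b ↦ a b`, and, for the conjugate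
bimodule `M⋆` of `M`, the isomorphisms `M ⊗ M⋆ ≅ L` and `M⋆ ⊗ M ≅ R` by the inner products, where
`L` and `R` are the closed ideals generated by the values of the inner products of `M`. Moreover
`M ⊗ R ≅ M` by `m ⊗ e ↦ m e`. Density of the images rests on
`HilbertBimodule.mem_closure_ract`: a vector `x` with `⟨x, x⟩` in a closed ideal `J` is a limit of
vectors `x e` with `e ∈ J`.

Consequently `[M] [M⋆] [M] = [M] [R] = [M]`, which gives each class `s` an inverse `t` such that
`s t` and `t s` are classes of ideals. If `s` is idempotent, then `t = t s s t` is a product of two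
classes of ideals, hence is idempotent, and so `s = s t t s` is a product of classes of ideals, that
is, the class of an ideal. Thus the idempotents are the classes of ideals; these commute, and
commutation of idempotents makes inverses unique. Finally, an isomorphism of ideals preserves
`x⋆ x`, which lies in a closed ideal exactly when `x` does, so the ideal is determined by its class.
-/

namespace CStarBimod

variable {A B C D : Type u} [NonUnitalCStarAlgebra A] [PartialOrder A] [StarOrderedRing A]
  [NonUnitalCStarAlgebra B] [PartialOrder B] [StarOrderedRing B]
  [NonUnitalCStarAlgebra C] [PartialOrder C] [StarOrderedRing C]
  [NonUnitalCStarAlgebra D] [PartialOrder D] [StarOrderedRing D]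

/-! ### Continuity of the inner products -/

namespace HilbertBimodule

variable (M : HilbertBimodule A B)

/-- A Hilbert bimodule with its Banach space structure forgotten. The estimates for semi-inner
products, such as the Cauchy-Schwarz inequality, are available for it. -/
def toPre : PreBimodule A B where
  carrier := M.carrier
  lact := M.lact
  ract := M.ract
  lact_mul := M.lact_mul
  ract_mul := M.ract_mul
  lact_ract := M.lact_ract
  linner := M.linner
  rinner := M.rinner
  star_linner := M.star_linner
  star_rinner := M.star_rinner
  linner_lact := M.linner_lact
  rinner_ract := M.rinner_ract
  linner_self_nonneg := M.linner_self_nonneg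
  rinner_self_nonneg := M.rinner_self_nonneg
  rinner_lact := M.rinner_lact
  linner_ract := M.linner_ract
  rinner_assoc w m n r := by rw [M.linner_lact_eq]
  linner_assoc w m n r := by rw [M.linner_lact_eq]

theorem norm_rinner_le (x y : M.carrier) :
    ‖M.rinner x y‖ ≤ √‖M.rinner x x‖ * √‖M.rinner y y‖ :=
  M.toPre.norm_rinner_le x y

theorem norm_linner_le (x y : M.carrier) :
    ‖M.linner x y‖ ≤ √‖M.rinner x x‖ * √‖M.rinner y y‖ :=
  M.toPre.norm_linner_le x y

theorem norm_rinner_lact_le (a : A) (x : M.carrier) :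
    ‖M.rinner x (M.lact a x)‖ ≤ ‖a‖ * ‖M.rinner x x‖ := by
  have h : ‖M.rinner (M.lact a x) (M.lact a x)‖ ≤ ‖a‖ ^ 2 * ‖M.rinner x x‖ :=
    M.toPre.norm_rinner_lact_le a x
  calc ‖M.rinner x (M.lact a x)‖
      ≤ √‖M.rinner x x‖ * √‖M.rinner (M.lact a x) (M.lact a x)‖ := M.norm_rinner_le _ _
    _ ≤ √‖M.rinner x x‖ * √(‖a‖ ^ 2 * ‖M.rinner x x‖) := by gcongr
    _ = ‖a‖ * (√‖M.rinner x x‖ * √‖M.rinner x x‖) := by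
      rw [Real.sqrt_mul (by positivity), Real.sqrt_sq (norm_nonneg _)]; ring
    _ = ‖a‖ * ‖M.rinner x x‖ := by rw [Real.mul_self_sqrt (norm_nonneg _)]

theorem exists_sqrt_rinner_le : ∃ c : ℝ, 0 < c ∧ ∀ m, √‖M.rinner m m‖ ≤ c * ‖m‖ :=
  let ⟨_, c, _, hc, h⟩ := M.norm_equiv_rinner
  ⟨c, hc, fun m => (h m).2⟩

theorem exists_le_sqrt_rinner : ∃ c : ℝ, 0 < c ∧ ∀ m, ‖m‖ ≤ c * √‖M.rinner m m‖ :=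
  let ⟨c, _, hc, _, h⟩ := M.norm_equiv_rinner
  ⟨c⁻¹, inv_pos.mpr hc, fun m => (le_inv_mul_iff₀ hc).mpr (h m).1⟩

/-- The right inner product as a continuous sesquilinear map. -/
noncomputable def rinnerL : M.carrier →L⋆[ℂ] M.carrier →L[ℂ] B :=
  LinearMap.mkContinuousOfExistsBound₂ M.rinner <| by
    obtain ⟨c, hc, h⟩ := M.exists_sqrt_rinner_le
    refine ⟨c * c, fun x y => (M.norm_rinner_le x y).trans ?_⟩
    calc _ ≤ (c * ‖x‖) * (c * ‖y‖) := by gcongr <;> apply h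
      _ = _ := by ring

/-- The left inner product as a continuous sesquilinear map. -/
noncomputable def linnerL : M.carrier →L[ℂ] M.carrier →L⋆[ℂ] A :=
  LinearMap.mkContinuousOfExistsBound₂ M.linner <| by
    obtain ⟨c, hc, h⟩ := M.exists_sqrt_rinner_le
    refine ⟨c * c, fun x y => (M.norm_linner_le x y).trans ?_⟩
    calc _ ≤ (c * ‖x‖) * (c * ‖y‖) := by gcongr <;> apply h
      _ = _ := by ring

@[fun_prop]
theorem continuous_rinner {X : Type*} [TopologicalSpace X] {f g : X → M.carrier}
    (hf : Continuous f) (hg : Continuous g) : Continuous fun x => M.rinner (f x) (g x) := by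
  have h : Continuous fun x => M.rinnerL (f x) (g x) := by fun_prop
  exact h

@[fun_prop]
theorem continuous_linner {X : Type*} [TopologicalSpace X] {f g : X → M.carrier}
    (hf : Continuous f) (hg : Continuous g) : Continuous fun x => M.linner (f x) (g x) := by
  have h : Continuous fun x => M.linnerL.flip (g x) (f x) := by fun_prop
  exact h

/-! ### Isomorphisms from Gram matrices -/

variable {M}
variable {N : HilbertBimodule A B}

/-- A bijection preserving both inner products preserves both actions, by definiteness. -/
theorem isIso_of_inner (e : M.carrier ≃L[ℂ] N.carrier)
    (hl : ∀ m n, N.linner (e m) (e n) = M.linner m n)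
    (hr : ∀ m n, N.rinner (e m) (e n) = M.rinner m n) : M.IsIso N := by
  refine ⟨⟨e, fun a m => ?_, fun b m => ?_, hl, hr⟩⟩
  · change e (M.lact a m) = N.lact a (e m)
    rw [← sub_eq_zero]
    apply N.linner_definite
    have h : ∀ n, N.linner (e (M.lact a m) - N.lact a (e m)) (e n) = 0 := fun n => by
      rw [map_sub, LinearMap.sub_apply, N.linner_lact, hl, hl, M.linner_lact, sub_self]
    simpa using h (e.symm (e (M.lact a m) - N.lact a (e m)))
  · change e (M.ract b m) = N.ract b (e m)
    rw [← sub_eq_zero]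
    apply N.rinner_definite
    have h : ∀ n, N.rinner (e n) (e (M.ract b m) - N.ract b (e m)) = 0 := fun n => by
      rw [map_sub, N.rinner_ract, hr, hr, M.rinner_ract, sub_self]
    simpa using h (e.symm (e (M.ract b m) - N.ract b (e m)))

end HilbertBimodule

/-- An operator which is bounded below and has dense range is invertible. -/
theorem exists_equiv_of_bounded_below {E F : Type*} [NormedAddCommGroup E] [NormedSpace ℂ E]
    [CompleteSpace E] [NormedAddCommGroup F] [NormedSpace ℂ F] [CompleteSpace F] (f : E →L[ℂ] F)
    {K : ℝ} (hK : 0 ≤ K) (h : ∀ x, ‖x‖ ≤ K * ‖f x‖) (hd : DenseRange f) :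
    ∃ e : E ≃L[ℂ] F, ∀ x, e x = f x := by
  have ha : AntilipschitzWith ⟨K, hK⟩ f := f.antilipschitz_of_bound h
  have hc : IsClosed (Set.range f) := ha.isClosed_range f.uniformContinuous
  refine ⟨ContinuousLinearEquiv.ofBijective f (LinearMap.ker_eq_bot.mpr ha.injective)
    (LinearMap.range_eq_top.mpr fun y => ?_), fun x => rfl⟩
  have : y ∈ closure (Set.range f) := hd y
  rwa [hc.closure_eq] at this

/-- Sesquilinear maps which agree on corresponding generators agree on the span of the pairs of
corresponding generators. -/
theorem sesquilinear_eq_of_mem_span_pair {ι E F G : Type*} [AddCommGroup E] [Module ℂ E]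
    [AddCommGroup F] [Module ℂ F] [AddCommGroup G] [Module ℂ G] {σ τ : ℂ →+* ℂ}
    (f : E →ₛₗ[σ] E →ₛₗ[τ] G) (g : F →ₛₗ[σ] F →ₛₗ[τ] G) (x : ι → E) (y : ι → F)
    (h : ∀ i j, f (x i) (x j) = g (y i) (y j)) {p q : E × F}
    (hp : p ∈ Submodule.span ℂ (Set.range fun i => (x i, y i)))
    (hq : q ∈ Submodule.span ℂ (Set.range fun i => (x i, y i))) : f p.1 q.1 = g p.2 q.2 := by
  induction hp using Submodule.span_induction with
  | zero => simp
  | add p p' _ _ hp hp' => simp [hp, hp']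
  | smul c p _ hp => simp [hp]
  | mem p hp =>
    obtain ⟨i, rfl⟩ := hp
    induction hq using Submodule.span_induction with
    | zero => simp
    | add p p' _ _ hp hp' => simp_all
    | smul c p _ hp => simp_all
    | mem q hq =>
      obtain ⟨j, rfl⟩ := hq
      exact h i j

namespace HilbertBimodule

variable {M N : HilbertBimodule A B}

/-- Hilbert bimodules which have families of vectors with dense span and with the same Gram
matrices are isomorphic. The isomorphism has the closed span of the pairs of corresponding vectors
as its graph: on this span both inner products agree, hence both projections are bounded below. -/
theorem isIso_of_gram {ι : Type*} (x : ι → M.carrier) (y : ι → N.carrier)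
    (hx : Dense (Submodule.span ℂ (Set.range x) : Set M.carrier))
    (hy : Dense (Submodule.span ℂ (Set.range y) : Set N.carrier))
    (hl : ∀ i j, M.linner (x i) (x j) = N.linner (y i) (y j))
    (hr : ∀ i j, M.rinner (x i) (x j) = N.rinner (y i) (y j)) : M.IsIso N := by
  let Γ₀ : Submodule ℂ (M.carrier × N.carrier) :=
    Submodule.span ℂ (Set.range fun i => (x i, y i))
  let Γ := Γ₀.topologicalClosure
  -- Closed conditions on pairs of vectors pass from the span to its closure.
  have hcl : ∀ (P : (M.carrier × N.carrier) → (M.carrier × N.carrier) → Prop),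
      IsClosed {z : (M.carrier × N.carrier) × (M.carrier × N.carrier) | P z.1 z.2} →
      (∀ p ∈ Γ₀, ∀ q ∈ Γ₀, P p q) → ∀ p ∈ Γ, ∀ q ∈ Γ, P p q := by
    intro P hP h p hp q hq
    have : (p, q) ∈ closure ((Γ₀ : Set (M.carrier × N.carrier)) ×ˢ (Γ₀ : Set _)) := by
      rw [closure_prod_eq]; exact ⟨hp, hq⟩
    exact (hP.closure_subset_iff.mpr fun z hz => h _ hz.1 _ hz.2) this
  have hΓl : ∀ p ∈ Γ, ∀ q ∈ Γ, M.linner p.1 q.1 = N.linner p.2 q.2 :=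
    hcl _ (isClosed_eq (by fun_prop) (by fun_prop)) fun p hp q hq =>
      sesquilinear_eq_of_mem_span_pair M.linner N.linner x y hl hp hq
  have hΓr : ∀ p ∈ Γ, ∀ q ∈ Γ, M.rinner p.1 q.1 = N.rinner p.2 q.2 :=
    hcl _ (isClosed_eq (by fun_prop) (by fun_prop)) fun p hp q hq =>
      sesquilinear_eq_of_mem_span_pair M.rinner N.rinner x y hr hp hq
  obtain ⟨c, hc, hMc⟩ := M.exists_sqrt_rinner_le
  obtain ⟨c', hc', hMc'⟩ := M.exists_le_sqrt_rinner
  obtain ⟨d, hd, hNd⟩ := N.exists_sqrt_rinner_le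
  obtain ⟨d', hd', hNd'⟩ := N.exists_le_sqrt_rinner
  have hcomplete : CompleteSpace Γ := Γ₀.isClosed_topologicalClosure.completeSpace_coe
  have hsub : ∀ i, (x i, y i) ∈ Γ := fun i =>
    Γ₀.le_topologicalClosure (Submodule.subset_span ⟨i, rfl⟩)
  obtain ⟨e, he⟩ := exists_equiv_of_bounded_below
    ((ContinuousLinearMap.fst ℂ M.carrier N.carrier).comp Γ.subtypeL) (K := max 1 (d' * c))
    (by positivity) (fun p => by
      have h1 : ‖p.1.2‖ ≤ d' * (c * ‖p.1.1‖) := (hNd' _).trans (by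
        rw [← hΓr _ p.2 _ p.2]; gcongr; exact hMc _)
      refine max_le ?_ (h1.trans ?_)
      · exact le_mul_of_one_le_left (norm_nonneg _) (le_max_left _ _)
      · rw [← mul_assoc]; exact mul_le_mul_of_nonneg_right (le_max_right _ _) (norm_nonneg _))
    (hx.mono <| (Submodule.span_le (p := LinearMap.range
      ((ContinuousLinearMap.fst ℂ M.carrier N.carrier).comp Γ.subtypeL).toLinearMap)).mpr <| by
        rintro _ ⟨i, rfl⟩; exact ⟨⟨_, hsub i⟩, rfl⟩)
  obtain ⟨e', he'⟩ := exists_equiv_of_bounded_below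
    ((ContinuousLinearMap.snd ℂ M.carrier N.carrier).comp Γ.subtypeL) (K := max 1 (c' * d))
    (by positivity) (fun p => by
      have h1 : ‖p.1.1‖ ≤ c' * (d * ‖p.1.2‖) := (hMc' _).trans (by
        rw [hΓr _ p.2 _ p.2]; gcongr; exact hNd _)
      refine max_le (h1.trans ?_) ?_
      · rw [← mul_assoc]; exact mul_le_mul_of_nonneg_right (le_max_right _ _) (norm_nonneg _)
      · exact le_mul_of_one_le_left (norm_nonneg _) (le_max_left _ _))
    (hy.mono <| (Submodule.span_le (p := LinearMap.range
      ((ContinuousLinearMap.snd ℂ M.carrier N.carrier).comp Γ.subtypeL).toLinearMap)).mpr <| by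
        rintro _ ⟨i, rfl⟩; exact ⟨⟨_, hsub i⟩, rfl⟩)
  have h1 : ∀ m, (e.symm m).1.1 = m := fun m => (he _).symm.trans (e.apply_symm_apply m)
  have h2 : ∀ m, (e.symm.trans e') m = (e.symm m).1.2 := fun m => he' _
  refine isIso_of_inner (e.symm.trans e') (fun m n => ?_) (fun m n => ?_)
  · rw [h2, h2, ← hΓl _ (e.symm m).2 _ (e.symm n).2, h1, h1]
  · rw [h2, h2, ← hΓr _ (e.symm m).2 _ (e.symm n).2, h1, h1]

/-! ### Elementary tensors -/

section Tensor

variable (M : HilbertBimodule A B) (N : HilbertBimodule B C)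

/-- The elementary tensor `m ⊗ n` in the interior tensor product, as a continuous bilinear map. -/
noncomputable def tmul : M.carrier →L[ℂ] N.carrier →L[ℂ] (M.tensor N).carrier :=
  LinearMap.mkContinuousOfExistsBound₂
    ((TensorProduct.mk ℂ M.carrier N.carrier).compr₂
      (Completion.toComplL (𝕜 := ℂ) (E := (tensorPre M N).carrier)).toLinearMap) <| by
    obtain ⟨c, hc, h⟩ := M.exists_sqrt_rinner_le
    obtain ⟨d, hd, h'⟩ := N.exists_sqrt_rinner_le
    refine ⟨c * d, fun x y => ?_⟩
    let z : (tensorPre M N).carrier := x ⊗ₜ[ℂ] y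
    change ‖(z : (tensorPre M N).Compl)‖ ≤ _
    rw [Completion.norm_coe, PreBimodule.norm_def]
    change √‖N.rinner y (N.lact (M.rinner x x) y)‖ ≤ _
    calc √‖N.rinner y (N.lact (M.rinner x x) y)‖
        ≤ √(‖M.rinner x x‖ * ‖N.rinner y y‖) := Real.sqrt_le_sqrt (N.norm_rinner_lact_le _ _)
      _ = √‖M.rinner x x‖ * √‖N.rinner y y‖ := Real.sqrt_mul (norm_nonneg _) _
      _ ≤ (c * ‖x‖) * (d * ‖y‖) := by gcongr <;> [apply h; apply h']
      _ = c * d * ‖x‖ * ‖y‖ := by ring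

theorem rinner_tmul (m m' : M.carrier) (n n' : N.carrier) :
    (M.tensor N).rinner (tmul M N m n) (tmul M N m' n') =
      N.rinner n (N.lact (M.rinner m m') n') :=
  (tensorPre M N).rinnerC_coe (m ⊗ₜ n) (m' ⊗ₜ n')

theorem linner_tmul (m m' : M.carrier) (n n' : N.carrier) :
    (M.tensor N).linner (tmul M N m n) (tmul M N m' n') =
      M.linner (M.ract (N.linner n n') m) m' :=
  (tensorPre M N).linnerC_coe (m ⊗ₜ n) (m' ⊗ₜ n')

theorem lact_tmul (a : A) (m : M.carrier) (n : N.carrier) :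
    (M.tensor N).lact a (tmul M N m n) = tmul M N (M.lact a m) n :=
  (tensorPre M N).lactC_coe a (m ⊗ₜ n)

theorem ract_tmul (c : C) (m : M.carrier) (n : N.carrier) :
    (M.tensor N).ract c (tmul M N m n) = tmul M N m (N.ract c n) :=
  (tensorPre M N).ractC_coe c (m ⊗ₜ n)

/-- The tensors of families with dense span have dense span. -/
theorem dense_span_tmul {ι κ : Type*} {x : ι → M.carrier} {y : κ → N.carrier}
    (hx : Dense (Submodule.span ℂ (Set.range x) : Set M.carrier))
    (hy : Dense (Submodule.span ℂ (Set.range y) : Set N.carrier)) :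
    Dense (Submodule.span ℂ (Set.range fun p : ι × κ => tmul M N (x p.1) (y p.2)) :
      Set (M.tensor N).carrier) := by
  set T := (Submodule.span ℂ
    (Set.range fun p : ι × κ => tmul M N (x p.1) (y p.2))).topologicalClosure with hT
  have hTc : IsClosed (T : Set (M.tensor N).carrier) := Submodule.isClosed_topologicalClosure _
  -- Membership in `T` is closed under limits in each factor separately.
  have h1 : ∀ i n, tmul M N (x i) n ∈ T := fun i n => by
    have hcl : IsClosed ((T.comap (tmul M N (x i)).toLinearMap : Submodule ℂ N.carrier) :
      Set N.carrier) := hTc.preimage (tmul M N (x i)).continuous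
    have hle : Submodule.span ℂ (Set.range y) ≤ T.comap (tmul M N (x i)).toLinearMap :=
      Submodule.span_le.mpr <| by
        rintro _ ⟨k, rfl⟩
        exact Submodule.le_topologicalClosure _ (Submodule.subset_span ⟨(i, k), rfl⟩)
    exact hcl.closure_subset_iff.mpr hle (hy n)
  have h2 : ∀ m n, tmul M N m n ∈ T := fun m n => by
    have hcl : IsClosed ((T.comap ((tmul M N).flip n).toLinearMap : Submodule ℂ M.carrier) :
      Set M.carrier) := hTc.preimage ((tmul M N).flip n).continuous
    have hle : Submodule.span ℂ (Set.range x) ≤ T.comap ((tmul M N).flip n).toLinearMap :=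
      Submodule.span_le.mpr <| by
        rintro _ ⟨k, rfl⟩
        exact h1 k n
    exact hcl.closure_subset_iff.mpr hle (hx m)
  have h3 : ∀ z : (tensorPre M N).carrier, (z : (tensorPre M N).Compl) ∈ T := fun z => by
    have : (⊤ : Submodule ℂ (M.carrier ⊗[ℂ] N.carrier)) ≤
        T.comap (Completion.toComplL (𝕜 := ℂ) (E := (tensorPre M N).carrier)).toLinearMap := by
      rw [← TensorProduct.span_tmul_eq_top]
      refine Submodule.span_le.mpr ?_
      rintro _ ⟨m, n, rfl⟩
      exact h2 m n
    exact this (Submodule.mem_top (x := z))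
  intro z
  have hz : z ∈ closure (Set.range ((↑) : (tensorPre M N).carrier → (tensorPre M N).Compl)) :=
    Completion.denseRange_coe z
  exact hTc.closure_subset_iff.mpr (by rintro _ ⟨w, rfl⟩; exact h3 w) hz

theorem dense_span_range_id {E : Type*} [NormedAddCommGroup E] [NormedSpace ℂ E] :
    Dense (Submodule.span ℂ (Set.range fun x : E => x) : Set E) := by
  simp

theorem tensor_assoc (K : HilbertBimodule C D) :
    ((M.tensor N).tensor K).IsIso (M.tensor (N.tensor K)) := by
  have h1 := dense_span_tmul (M.tensor N) K
    (dense_span_tmul M N dense_span_range_id dense_span_range_id) dense_span_range_id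
  have h2 := dense_span_tmul M (N.tensor K) dense_span_range_id
    (dense_span_tmul N K dense_span_range_id dense_span_range_id)
  rw [← (Equiv.prodAssoc _ _ _).surjective.range_comp] at h2
  refine isIso_of_gram _ _ h1 h2 (fun p q => ?_) (fun p q => ?_)
  · simp only [Function.comp_apply, Equiv.prodAssoc_apply, linner_tmul, ract_tmul]
  · simp only [Function.comp_apply, Equiv.prodAssoc_apply, rinner_tmul, lact_tmul]

end Tensor

end HilbertBimodule

/-! ### Approximation of vectors by means of closed ideals -/

/-- The selfadjoint part `J ∩ J⋆` of a closed two-sided ideal, as a C⋆-subalgebra. -/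
def starSubalgebraOfIdeal (J : TwoSidedIdeal A) (hJ : IsClosed (J : Set A)) :
    NonUnitalStarSubalgebra ℂ A where
  carrier := {a | a ∈ J ∧ star a ∈ J}
  add_mem' ha hb := ⟨J.add_mem ha.1 hb.1, by rw [star_add]; exact J.add_mem ha.2 hb.2⟩
  zero_mem' := ⟨J.zero_mem, by rw [star_zero]; exact J.zero_mem⟩
  mul_mem' ha hb := ⟨J.mul_mem_left _ _ hb.1, by rw [star_mul]; exact J.mul_mem_left _ _ ha.2⟩
  smul_mem' c x hx := ⟨(idealSubmodule J hJ).smul_mem c hx.1, by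
    rw [star_smul]; exact (idealSubmodule J hJ).smul_mem _ hx.2⟩
  star_mem' ha := ⟨ha.2, by rw [star_star]; exact ha.1⟩

theorem isClosed_starSubalgebraOfIdeal (J : TwoSidedIdeal A) (hJ : IsClosed (J : Set A)) :
    IsClosed (starSubalgebraOfIdeal J hJ : Set A) :=
  hJ.inter (hJ.preimage continuous_star)

namespace HilbertBimodule

/-- If `⟨x, x⟩` lies in a closed ideal `J`, then `x` is a limit of vectors `x e` with `e ∈ J`. -/
theorem mem_closure_ract (M : HilbertBimodule A B) (J : TwoSidedIdeal B)
    (hJ : IsClosed (J : Set B)) (x : M.carrier) (hx : M.rinner x x ∈ J) :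
    x ∈ closure ((fun e => M.ract e x) '' (J : Set B)) := by
  let S := starSubalgebraOfIdeal J hJ
  have hS : IsClosed (S : Set B) := isClosed_starSubalgebraOfIdeal J hJ
  let _ : NonUnitalCStarAlgebra S := NonUnitalStarSubalgebra.nonUnitalCStarAlgebra S
  let _ : PartialOrder S := CStarAlgebra.spectralOrder S
  have _ : StarOrderedRing S := CStarAlgebra.spectralOrderedRing S
  obtain ⟨c, hc, h⟩ := M.exists_le_sqrt_rinner
  let v : S := ⟨M.rinner x x, hx, by rw [M.star_rinner]; exact hx⟩
  -- The constant `c` compensates for the norm of `M` being merely equivalent to the module norm.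
  refine closure_mono ?_ (mem_closure_range_right (fun e : S => M.ract (e : B) x) x
    (((c ^ 2 : ℝ) : ℂ) • v) fun e => ?_)
  · rintro _ ⟨e, rfl⟩
    exact ⟨e, e.2.1, rfl⟩
  · have e1 : M.rinner (x - M.ract (e : B) x) (x - M.ract (e : B) x) =
        ((v - v * e : S) : B) - star (e : B) * ((v - v * e : S) : B) := by
      change _ = (M.rinner x x - M.rinner x x * e) -
        star (e : B) * (M.rinner x x - M.rinner x x * e)
      simp only [map_sub, LinearMap.sub_apply, M.rinner_ract, M.rinner_ract_left, mul_sub,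
        mul_assoc]
      abel
    have e2 : ‖M.rinner (x - M.ract (e : B) x) (x - M.ract (e : B) x)‖ ≤
        ‖v - v * e‖ * (1 + ‖e‖) := by
      rw [e1]
      refine (norm_sub_le _ _).trans ?_
      have h3 := norm_mul_le (star (e : B)) ((v - v * e : S) : B)
      rw [norm_star] at h3
      change ‖((v - v * e : S) : B)‖ + _ ≤ ‖((v - v * e : S) : B)‖ * (1 + ‖(e : B)‖)
      linarith
    have e3 : ((c ^ 2 : ℝ) : ℂ) • v - ((c ^ 2 : ℝ) : ℂ) • v * e =
        ((c ^ 2 : ℝ) : ℂ) • (v - v * e) := by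
      rw [smul_sub, smul_mul_assoc]
    rw [e3, norm_smul, Complex.norm_real, Real.norm_of_nonneg (by positivity), mul_assoc]
    calc ‖x - M.ract (e : B) x‖ ^ 2
        ≤ (c * √‖M.rinner (x - M.ract (e : B) x) (x - M.ract (e : B) x)‖) ^ 2 := by
          gcongr; exact h _
      _ = c ^ 2 * ‖M.rinner (x - M.ract (e : B) x) (x - M.ract (e : B) x)‖ := by
          rw [mul_pow, Real.sq_sqrt (norm_nonneg _)]
      _ ≤ _ := by gcongr

end HilbertBimodule

/-! ### The ideals generated by the inner products -/

/-- The closed span of a set which absorbs products, as a two-sided ideal. -/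
def closedSpanIdeal (s : Set A) (hl : ∀ a, ∀ x ∈ s, a * x ∈ s) (hr : ∀ a, ∀ x ∈ s, x * a ∈ s) :
    TwoSidedIdeal A :=
  TwoSidedIdeal.mk' ((Submodule.span ℂ s).topologicalClosure : Set A)
    (Submodule.zero_mem _) (Submodule.add_mem _) (Submodule.neg_mem _)
    (fun {a x} hx => by
      refine map_mem_closure (f := fun x => a * x) (by fun_prop) hx fun y hy => ?_
      exact (Submodule.span_le (p := (Submodule.span ℂ s).comap (LinearMap.mulLeft ℂ a))).mpr
        (fun z hz => Submodule.subset_span (hl a z hz)) hy)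
    (fun {x a} hx => by
      refine map_mem_closure (f := fun x => x * a) (by fun_prop) hx fun y hy => ?_
      exact (Submodule.span_le (p := (Submodule.span ℂ s).comap (LinearMap.mulRight ℂ a))).mpr
        (fun z hz => Submodule.subset_span (hr a z hz)) hy)

omit [PartialOrder A] [StarOrderedRing A] in
theorem coe_closedSpanIdeal (s : Set A) (hl : ∀ a, ∀ x ∈ s, a * x ∈ s)
    (hr : ∀ a, ∀ x ∈ s, x * a ∈ s) :
    (closedSpanIdeal s hl hr : Set A) = closure (Submodule.span ℂ s) :=
  TwoSidedIdeal.coe_mk' ..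

omit [PartialOrder A] [StarOrderedRing A] in
theorem isClosed_closedSpanIdeal (s : Set A) (hl : ∀ a, ∀ x ∈ s, a * x ∈ s)
    (hr : ∀ a, ∀ x ∈ s, x * a ∈ s) : IsClosed (closedSpanIdeal s hl hr : Set A) := by
  rw [coe_closedSpanIdeal]; exact isClosed_closure

omit [PartialOrder A] [StarOrderedRing A] in
theorem subset_closedSpanIdeal {s : Set A} {hl : ∀ a, ∀ x ∈ s, a * x ∈ s}
    {hr : ∀ a, ∀ x ∈ s, x * a ∈ s} {x : A} (hx : x ∈ s) : x ∈ closedSpanIdeal s hl hr := by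
  rw [← SetLike.mem_coe, coe_closedSpanIdeal]
  exact subset_closure (Submodule.subset_span hx)

/-- A family enumerating the generating set has dense span in the closed span. -/
theorem dense_span_closedSpanIdeal {ι : Type*} (f : ι → A)
    (hl : ∀ a, ∀ x ∈ Set.range f, a * x ∈ Set.range f)
    (hr : ∀ a, ∀ x ∈ Set.range f, x * a ∈ Set.range f) :
    Dense (Submodule.span ℂ (Set.range fun i =>
      (⟨f i, subset_closedSpanIdeal ⟨i, rfl⟩⟩ : idealSubmodule (closedSpanIdeal _ hl hr)
        (isClosed_closedSpanIdeal _ hl hr))) :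
      Set (idealSubmodule (closedSpanIdeal _ hl hr) (isClosed_closedSpanIdeal _ hl hr))) := by
  intro z
  rw [closure_subtype]
  have hz : (z : A) ∈ closure (Submodule.span ℂ (Set.range f) : Set A) := by
    rw [← coe_closedSpanIdeal _ hl hr]; exact z.2
  refine closure_mono ?_ hz
  rw [← Submodule.coe_subtype, ← Submodule.map_coe, Submodule.map_span, ← Set.range_comp]
  rfl

namespace HilbertBimodule

variable (M : HilbertBimodule A B)

theorem mul_mem_range_linner (a : A) :
    ∀ x ∈ Set.range fun p : M.carrier × M.carrier => M.linner p.1 p.2,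
      a * x ∈ Set.range fun p : M.carrier × M.carrier => M.linner p.1 p.2 := by
  rintro _ ⟨⟨m, n⟩, rfl⟩
  exact ⟨(M.lact a m, n), M.linner_lact a m n⟩

theorem linner_mul_mem_range (a : A) :
    ∀ x ∈ Set.range fun p : M.carrier × M.carrier => M.linner p.1 p.2,
      x * a ∈ Set.range fun p : M.carrier × M.carrier => M.linner p.1 p.2 := by
  rintro _ ⟨⟨m, n⟩, rfl⟩
  exact ⟨(m, M.lact (star a) n), by simp only [linner_lact_right, star_star]⟩

theorem mul_mem_range_rinner (b : B) :
    ∀ x ∈ Set.range fun p : M.carrier × M.carrier => M.rinner p.1 p.2,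
      b * x ∈ Set.range fun p : M.carrier × M.carrier => M.rinner p.1 p.2 := by
  rintro _ ⟨⟨m, n⟩, rfl⟩
  exact ⟨(M.ract (star b) m, n), by simp only [rinner_ract_left, star_star]⟩

theorem rinner_mul_mem_range (b : B) :
    ∀ x ∈ Set.range fun p : M.carrier × M.carrier => M.rinner p.1 p.2,
      x * b ∈ Set.range fun p : M.carrier × M.carrier => M.rinner p.1 p.2 := by
  rintro _ ⟨⟨m, n⟩, rfl⟩
  exact ⟨(m, M.ract b n), M.rinner_ract b m n⟩

/-- The closed ideal generated by the values of the left inner product. -/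
def leftIdeal : {J : TwoSidedIdeal A // IsClosed (J : Set A)} :=
  ⟨closedSpanIdeal _ M.mul_mem_range_linner M.linner_mul_mem_range,
    isClosed_closedSpanIdeal _ _ _⟩

/-- The closed ideal generated by the values of the right inner product. -/
def rightIdeal : {J : TwoSidedIdeal B // IsClosed (J : Set B)} :=
  ⟨closedSpanIdeal _ M.mul_mem_range_rinner M.rinner_mul_mem_range,
    isClosed_closedSpanIdeal _ _ _⟩

theorem rinner_mem_rightIdeal (m n : M.carrier) : M.rinner m n ∈ M.rightIdeal.1 :=
  subset_closedSpanIdeal (hl := M.mul_mem_range_rinner) (hr := M.rinner_mul_mem_range)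
    ⟨(m, n), rfl⟩

end HilbertBimodule

/-! ### Products with ideals -/

namespace HilbertBimodule

section Ideal

variable (M : HilbertBimodule A B) (J : TwoSidedIdeal B) (hJ : IsClosed (J : Set B))

theorem linner_tmul_ideal (m n : M.carrier) (e f : idealSubmodule J hJ) :
    (M.tensor (idealBimodule J hJ)).linner (tmul M (idealBimodule J hJ) m e)
      (tmul M (idealBimodule J hJ) n f) = M.linner (M.ract (e.1 * star f.1) m) n :=
  linner_tmul ..

theorem rinner_tmul_ideal (m n : M.carrier) (e f : idealSubmodule J hJ) :
    (M.tensor (idealBimodule J hJ)).rinner (tmul M (idealBimodule J hJ) m e)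
      (tmul M (idealBimodule J hJ) n f) = star e.1 * (M.rinner m n * f.1) :=
  rinner_tmul ..

theorem dense_span_tmul_ideal :
    Dense (Submodule.span ℂ (Set.range fun p : M.carrier × idealSubmodule J hJ =>
      tmul M (idealBimodule J hJ) p.1 p.2) : Set (M.tensor (idealBimodule J hJ)).carrier) :=
  dense_span_tmul M (idealBimodule J hJ) (x := fun m => m)
    (y := fun e : (idealBimodule J hJ).carrier => e) dense_span_range_id dense_span_range_id

/-- The multiplication `m ⊗ e ↦ m e` is an isomorphism from `M ⊗ J` onto `M` as soon as the right
inner product of `M` has its values in `J`. -/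
theorem tensor_idealBimodule_isIso (h : ∀ m, M.rinner m m ∈ J) :
    (M.tensor (idealBimodule J hJ)).IsIso M := by
  refine isIso_of_gram _ (fun p : M.carrier × idealSubmodule J hJ => M.ract p.2.1 p.1)
    (dense_span_tmul_ideal M J hJ) (fun m => ?_) ?_ ?_
  · refine closure_mono ?_ (M.mem_closure_ract J hJ m (h m))
    rintro _ ⟨e, he, rfl⟩
    exact Submodule.subset_span ⟨(m, ⟨e, he⟩), rfl⟩
  · rintro ⟨m, e⟩ ⟨n, f⟩
    rw [linner_tmul_ideal, M.ract_mul, M.linner_ract, star_star]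
  · rintro ⟨m, e⟩ ⟨n, f⟩
    rw [rinner_tmul_ideal, M.rinner_ract, rinner_ract_left, mul_assoc]

end Ideal

end HilbertBimodule

/-- The product of two closed ideals is their intersection: `a ⊗ b ↦ a b`. -/
theorem idealBimodule_tensor_isIso (I J : TwoSidedIdeal A) (hI : IsClosed (I : Set A))
    (hJ : IsClosed (J : Set A)) :
    ((idealBimodule I hI).tensor (idealBimodule J hJ)).IsIso
      (idealBimodule (I ⊓ J) (hI.inter hJ)) := by
  refine HilbertBimodule.isIso_of_gram _
    (fun p : idealSubmodule I hI × idealSubmodule J hJ =>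
      (⟨p.1.1 * p.2.1, I.mul_mem_right _ _ p.1.2, J.mul_mem_left _ _ p.2.2⟩ :
        idealSubmodule (I ⊓ J) (hI.inter hJ)))
    (HilbertBimodule.dense_span_tmul_ideal (idealBimodule I hI) J hJ) (fun x => ?_) ?_ ?_
  · refine closure_mono ?_ ((idealBimodule (I ⊓ J) (hI.inter hJ)).mem_closure_ract J hJ x
      (J.mul_mem_left _ _ x.2.2))
    rintro _ ⟨e, he, rfl⟩
    exact Submodule.subset_span ⟨(⟨x.1, x.2.1⟩, ⟨e, he⟩), rfl⟩
  · rintro ⟨a, b⟩ ⟨a', b'⟩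
    refine (HilbertBimodule.linner_tmul_ideal (idealBimodule I hI) J hJ a a' b b').trans ?_
    change a.1 * (b.1 * star b'.1) * star a'.1 = a.1 * b.1 * star (a'.1 * b'.1)
    simp only [star_mul, mul_assoc]
  · rintro ⟨a, b⟩ ⟨a', b'⟩
    refine (HilbertBimodule.rinner_tmul_ideal (idealBimodule I hI) J hJ a a' b b').trans ?_
    change star b.1 * (star a.1 * a'.1 * b'.1) = star (a.1 * b.1) * (a'.1 * b'.1)
    simp only [star_mul, mul_assoc]

/-- An isomorphism `I ≅ J` preserves `x⋆ x`, which determines whether `x` lies in a closed ideal. -/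
theorem le_of_idealBimodule_isIso {I J : TwoSidedIdeal A} {hI : IsClosed (I : Set A)}
    {hJ : IsClosed (J : Set A)} (h : (idealBimodule I hI).IsIso (idealBimodule J hJ)) :
    I ≤ J := by
  obtain ⟨f⟩ := h
  intro x hx
  have h1 : star x * x ∈ J := by
    have h2 := f.map_rinner (⟨x, hx⟩ : idealSubmodule I hI) (⟨x, hx⟩ : idealSubmodule I hI)
    change star (f.toFun _ : idealSubmodule J hJ).1 * (f.toFun _ : idealSubmodule J hJ).1 =
      star x * x at h2
    rw [← h2]
    exact J.mul_mem_left _ _ (Subtype.property _)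
  have h3 := (idealBimodule I hI).mem_closure_ract J hJ (⟨x, hx⟩ : idealSubmodule I hI) h1
  have h4 := map_mem_closure (f := ((↑) : idealSubmodule I hI → A)) (t := (J : Set A))
    continuous_subtype_val h3 (by
      rintro _ ⟨e, he, rfl⟩
      exact J.mul_mem_left _ _ he)
  rwa [hJ.closure_eq] at h4

/-! ### The conjugate bimodule -/

/-- The conjugate of a complex vector space: the same additive group, on which `c` acts as its
complex conjugate. -/
def Conj (E : Type*) : Type _ := E

namespace Conj

variable {E : Type*} [NormedAddCommGroup E] [NormedSpace ℂ E]

instance : NormedAddCommGroup (Conj E) := inferInstanceAs (NormedAddCommGroup E)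

instance [CompleteSpace E] : CompleteSpace (Conj E) := inferInstanceAs (CompleteSpace E)

instance : Module ℂ (Conj E) := (Module.compHom E (starRingEnd ℂ) : Module ℂ E)

instance : NormedSpace ℂ (Conj E) where
  norm_smul_le c x := by
    change ‖starRingEnd ℂ c • (show E from x)‖ ≤ ‖c‖ * ‖(show E from x)‖
    rw [norm_smul, RCLike.norm_conj]

/-- The span of a set is contained in its span in the conjugate space. -/
theorem coe_span_subset (s : Set E) :
    (Submodule.span ℂ s : Set E) ⊆ (Submodule.span ℂ (show Set (Conj E) from s) : Set (Conj E)) := by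
  let T := Submodule.span ℂ (show Set (Conj E) from s)
  let p : Submodule ℂ E :=
    { carrier := (T : Set (Conj E))
      add_mem' := T.add_mem
      zero_mem' := T.zero_mem
      smul_mem' := fun c x hx => by
        have h := T.smul_mem (starRingEnd ℂ c) hx
        change (starRingEnd ℂ (starRingEnd ℂ c) • x : E) ∈ (T : Set (Conj E)) at h
        rwa [Complex.conj_conj] at h }
  exact (Submodule.span_le (p := p)).mpr (Submodule.subset_span (R := ℂ) (M := Conj E))

end Conj

namespace HilbertBimodule

/-- The conjugate bimodule `M⋆` of `M`, whose actions are `b m = m b⋆` and `m a = a⋆ m`, and whose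
left and right inner products are the right and left inner products of `M`. -/
def conj (M : HilbertBimodule A B) : HilbertBimodule B A where
  carrier := Conj M.carrier
  lact := LinearMap.mk₂ ℂ (fun b m => (M.ract (star b) m : M.carrier))
    (fun b b' m => by rw [star_add, map_add]; rfl)
    (fun c b m => by rw [star_smul, map_smul]; rfl)
    (fun b m m' => map_add (M.ract (star b)) m m')
    (fun c b m => LinearMap.map_smul (M.ract (star b)) (starRingEnd ℂ c) (show M.carrier from m))
  ract := LinearMap.mk₂ ℂ (fun a m => (M.lact (star a) m : M.carrier))
    (fun b b' m => by rw [star_add, map_add]; rfl)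
    (fun c b m => by rw [star_smul, map_smul]; rfl)
    (fun b m m' => map_add (M.lact (star b)) m m')
    (fun c b m => LinearMap.map_smul (M.lact (star b)) (starRingEnd ℂ c) (show M.carrier from m))
  lact_mul b b' m := (congrArg (fun c => M.ract c m) (star_mul b b')).trans (M.ract_mul _ _ m)
  ract_mul a a' m := (congrArg (fun c => M.lact c m) (star_mul a a')).trans (M.lact_mul _ _ m)
  lact_ract b a m := (M.lact_ract (star a) (star b) m).symm
  lact_nondegenerate := by
    refine Dense.mono ((Conj.coe_span_subset (E := M.carrier) _).trans (Submodule.span_mono (R := ℂ)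
      (M := Conj M.carrier) ?_)) M.ract_nondegenerate
    rintro _ ⟨b, m, rfl⟩
    exact ⟨star b, m, congrArg (fun b => M.ract b m) (star_star b)⟩
  ract_nondegenerate := by
    refine Dense.mono ((Conj.coe_span_subset (E := M.carrier) _).trans (Submodule.span_mono (R := ℂ)
      (M := Conj M.carrier) ?_)) M.lact_nondegenerate
    rintro _ ⟨b, m, rfl⟩
    exact ⟨star b, m, congrArg (fun b => M.lact b m) (star_star b)⟩
  linner := LinearMap.mk₂'ₛₗ (RingHom.id ℂ) (starRingEnd ℂ)
    (fun m n => M.rinner (show M.carrier from m) (show M.carrier from n))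
    (fun m m' n => LinearMap.map_add₂ M.rinner m m' n)
    (fun c m n => (LinearMap.map_smulₛₗ₂ M.rinner (starRingEnd ℂ c) m n).trans
      (by rw [Complex.conj_conj]; rfl))
    (fun m n n' => map_add (M.rinner m) n n')
    (fun c m n => LinearMap.map_smul (M.rinner m) (starRingEnd ℂ c) (show M.carrier from n))
  rinner := LinearMap.mk₂'ₛₗ (starRingEnd ℂ) (RingHom.id ℂ)
    (fun m n => M.linner (show M.carrier from m) (show M.carrier from n))
    (fun m m' n => LinearMap.map_add₂ M.linner m m' n)
    (fun c m n => LinearMap.map_smul₂ M.linner (starRingEnd ℂ c) m n)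
    (fun m n n' => map_add (M.linner m) n n')
    (fun c m n => (LinearMap.map_smulₛₗ (M.linner m) (starRingEnd ℂ c) n).trans
      (by rw [Complex.conj_conj]; rfl))
  star_linner := M.star_rinner
  star_rinner := M.star_linner
  linner_lact b m n := (M.rinner_ract_left (star b) m n).trans (by rw [star_star]; rfl)
  rinner_ract a m n := (M.linner_lact_right (star a) m n).trans (by rw [star_star]; rfl)
  linner_self_nonneg := M.rinner_self_nonneg
  rinner_self_nonneg := M.linner_self_nonneg
  linner_definite := M.rinner_definite
  rinner_definite := M.linner_definite
  rinner_lact b := M.linner_ract (star b)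
  linner_ract a := M.rinner_lact (star a)
  norm_equiv_linner := M.norm_equiv_rinner
  norm_equiv_rinner := M.norm_equiv_linner
  linner_lact_eq m n r :=
    have h : ∀ m n r : M.carrier,
        M.ract (star (M.rinner m n)) r = M.lact (star (M.linner n r)) m := fun m n r => by
      rw [M.star_rinner, M.star_linner, M.linner_lact_eq]
    h m n r

variable (M : HilbertBimodule A B)

/-- The map `m ⊗ n ↦ ⟨m, n⟩` is an isomorphism from `M ⊗ M⋆` onto the ideal generated by the left
inner product. -/
theorem tensor_conj_isIso :
    (M.tensor M.conj).IsIso (idealBimodule M.leftIdeal.1 M.leftIdeal.2) := by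
  refine isIso_of_gram _ _ (dense_span_tmul M M.conj (y := fun n : M.carrier => n)
    dense_span_range_id dense_span_range_id)
    (dense_span_closedSpanIdeal _ M.mul_mem_range_linner M.linner_mul_mem_range) ?_ ?_
  · rintro ⟨m, n⟩ ⟨m', n'⟩
    refine (linner_tmul M M.conj m m' n n').trans ?_
    change M.linner (M.ract (M.rinner n n') m) m' = M.linner m n * star (M.linner m' n')
    rw [← M.linner_lact_eq, M.linner_lact, M.star_linner]
  · rintro ⟨m, n⟩ ⟨m', n'⟩
    refine (rinner_tmul M M.conj m m' n n').trans ?_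
    change M.linner n (M.ract (star (M.rinner m m')) n') = star (M.linner m n) * M.linner m' n'
    rw [← M.linner_ract, ← M.linner_lact_eq, M.linner_lact, M.star_linner]

/-- The map `m ⊗ n ↦ ⟨m, n⟩` is an isomorphism from `M⋆ ⊗ M` onto the ideal generated by the right
inner product. -/
theorem conj_tensor_isIso :
    (M.conj.tensor M).IsIso (idealBimodule M.rightIdeal.1 M.rightIdeal.2) := by
  refine isIso_of_gram _ _ (dense_span_tmul M.conj M (x := fun n : M.carrier => n)
    dense_span_range_id dense_span_range_id)
    (dense_span_closedSpanIdeal _ M.mul_mem_range_rinner M.rinner_mul_mem_range) ?_ ?_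
  · rintro ⟨m, n⟩ ⟨m', n'⟩
    refine (linner_tmul M.conj M m m' n n').trans ?_
    change M.rinner (M.lact (star (M.linner n n')) m) m' = M.rinner m n * star (M.rinner m' n')
    rw [M.rinner_lact, star_star, M.linner_lact_eq, M.rinner_ract, M.star_rinner]
  · rintro ⟨m, n⟩ ⟨m', n'⟩
    refine (rinner_tmul M.conj M m m' n n').trans ?_
    change M.rinner n (M.lact (M.linner m m') n') = star (M.rinner m n) * M.rinner m' n'
    rw [M.linner_lact_eq, M.rinner_ract, M.star_rinner]

end HilbertBimodule

/-! ### The semigroup `S(A)` -/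

namespace S

theorem mul_assoc (r s t : S A) : r * s * t = r * (s * t) := by
  induction r using Quotient.inductionOn with | _ M
  induction s using Quotient.inductionOn with | _ N
  induction t using Quotient.inductionOn with | _ K
  exact mk_eq_mk.mpr (M.tensor_assoc N K)

theorem ofIdeal_mul_ofIdeal (I J : {J : TwoSidedIdeal A // IsClosed (J : Set A)}) :
    ofIdeal I * ofIdeal J = ofIdeal ⟨I.1 ⊓ J.1, I.2.inter J.2⟩ :=
  mk_eq_mk.mpr (idealBimodule_tensor_isIso I.1 J.1 I.2 J.2)

theorem ofIdeal_mul_comm (I J : {J : TwoSidedIdeal A // IsClosed (J : Set A)}) :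
    ofIdeal I * ofIdeal J = ofIdeal J * ofIdeal I := by
  rw [ofIdeal_mul_ofIdeal, ofIdeal_mul_ofIdeal]
  congr 2
  exact inf_comm _ _

theorem ofIdeal_mul_self (J : {J : TwoSidedIdeal A // IsClosed (J : Set A)}) :
    ofIdeal J * ofIdeal J = ofIdeal J := by
  rw [ofIdeal_mul_ofIdeal]
  congr 2
  exact inf_idem _

theorem ofIdeal_injective : Function.Injective (ofIdeal (A := A)) := fun _ _ h =>
  have h' := mk_eq_mk.mp h
  Subtype.ext (le_antisymm (le_of_idealBimodule_isIso h')
    (le_of_idealBimodule_isIso (HilbertBimodule.isIso_equivalence.symm h')))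

/-- Every class has an inverse, and the products with it are classes of ideals. -/
theorem exists_inverse (s : S A) : ∃ t : S A, s * t * s = s ∧ t * s * t = t ∧
    (∃ I, ofIdeal I = s * t) ∧ ∃ J, ofIdeal J = t * s := by
  induction s using Quotient.inductionOn with | _ M
  change ∃ t : S A, mk M * t * mk M = mk M ∧ t * mk M * t = t ∧ (∃ I, ofIdeal I = mk M * t) ∧
    ∃ J, ofIdeal J = t * mk M
  have h1 : mk M * mk M.conj = ofIdeal M.leftIdeal := mk_eq_mk.mpr M.tensor_conj_isIso
  have h2 : mk M.conj * mk M = ofIdeal M.rightIdeal := mk_eq_mk.mpr M.conj_tensor_isIso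
  have h3 : mk M * ofIdeal M.rightIdeal = mk M :=
    mk_eq_mk.mpr (M.tensor_idealBimodule_isIso _ _ fun m => M.rinner_mem_rightIdeal m m)
  have h4 : mk M * (mk M.conj * mk M) = mk M := by rw [h2, h3]
  have h5 : ∀ x, mk M * (mk M.conj * (mk M * x)) = mk M * x := fun x => by
    rw [← mul_assoc (mk M.conj), ← mul_assoc (mk M), h4]
  -- If `s t s = s`, then `t s t` is an inverse of `s` with the same products.
  refine ⟨mk M.conj * mk M * mk M.conj, ?_, ?_, ⟨M.leftIdeal, ?_⟩, ⟨M.rightIdeal, ?_⟩⟩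
  · simp only [mul_assoc, h4]
  · simp only [mul_assoc, h5]
  · rw [← mul_assoc, h4, h1]
  · rw [mul_assoc, mul_assoc, h4, h2]

/-- An idempotent `s` with inverse `t` satisfies `t = (t s) (s t)` and `s = (s t) (t s)`; as `s t`
and `t s` are classes of ideals, so are `t` and `s`. -/
theorem exists_ofIdeal_eq {s : S A} (h : s * s = s) : ∃ J, ofIdeal J = s := by
  obtain ⟨t, hst, hts, ⟨I, hI⟩, ⟨J, hJ⟩⟩ := exists_inverse s
  have h1 : t = ofIdeal J * ofIdeal I := by
    rw [hI, hJ, ← mul_assoc, mul_assoc t, h, hts]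
  have h2 : t * t = t := by
    rw [h1, ofIdeal_mul_ofIdeal, ofIdeal_mul_self]
  have h3 : s = ofIdeal I * ofIdeal J := by
    rw [hI, hJ, ← mul_assoc, mul_assoc s, h2, hst]
  exact ⟨_, ((ofIdeal_mul_ofIdeal I J).symm.trans h3.symm)⟩

theorem mul_comm_of_idempotent {e f : S A} (he : e * e = e) (hf : f * f = f) :
    e * f = f * e := by
  obtain ⟨I, rfl⟩ := exists_ofIdeal_eq he
  obtain ⟨J, rfl⟩ := exists_ofIdeal_eq hf
  exact ofIdeal_mul_comm I J

/-- Inverses are unique because idempotents commute. -/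
theorem inverse_unique {s t t' : S A} (h1 : s * t * s = s) (h2 : t * s * t = t)
    (h1' : s * t' * s = s) (h2' : t' * s * t' = t') : t = t' := by
  have hl : (t * s) * (t' * s) = (t' * s) * (t * s) := by
    refine mul_comm_of_idempotent ?_ ?_
    · rw [← mul_assoc, h2]
    · rw [← mul_assoc, h2']
  have hr : (s * t) * (s * t') = (s * t') * (s * t) := by
    refine mul_comm_of_idempotent ?_ ?_
    · rw [← mul_assoc, h1]
    · rw [← mul_assoc, h1']
  have e1 : t * s = t' * s := by
    calc t * s = t * (s * t' * s) := by rw [h1']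
      _ = (t * s) * (t' * s) := by simp only [mul_assoc]
      _ = (t' * s) * (t * s) := hl
      _ = t' * (s * t * s) := by simp only [mul_assoc]
      _ = t' * s := by rw [h1]
  have e2 : s * t = s * t' := by
    calc s * t = (s * t' * s) * t := by rw [h1']
      _ = (s * t') * (s * t) := by simp only [mul_assoc]
      _ = (s * t) * (s * t') := hr.symm
      _ = (s * t * s) * t' := by simp only [mul_assoc]
      _ = s * t' := by rw [h1]
  rw [← h2, e1, mul_assoc, e2, ← mul_assoc, h2']

end S

end CStarBimod
/-- Let `A` be a C⋆-algebra. The isomorphism classes of associative Hilbert bimodules over `A`, with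
the interior tensor product over `A` as multiplication, form an inverse semigroup `S(A)`. It is
regular, sending a closed two-sided ideal to its class is a bijection onto the idempotents of
`S(A)`, the product of the classes of two ideals is the class of their intersection, and idempotents
commute. -/
theorem mainTheorem1 {A : Type*} [NonUnitalCStarAlgebra A] [PartialOrder A] [StarOrderedRing A] :
    CStarBimod.IsInverseSemigroup (CStarBimod.S A) ∧
    (∀ s : CStarBimod.S A, ∃ t : CStarBimod.S A, s * t * s = s ∧ t * s * t = t) ∧
    Function.Injective (CStarBimod.S.ofIdeal (A := A)) ∧
    (∀ s : CStarBimod.S A, s * s = s ↔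
      ∃ J : {J : TwoSidedIdeal A // IsClosed (J : Set A)}, CStarBimod.S.ofIdeal J = s) ∧
    (∀ I J : {J : TwoSidedIdeal A // IsClosed (J : Set A)},
      CStarBimod.S.ofIdeal I * CStarBimod.S.ofIdeal J =
        CStarBimod.S.ofIdeal ⟨I.1 ⊓ J.1, I.2.inter J.2⟩) ∧
    (∀ e f : CStarBimod.S A, e * e = e → f * f = f → e * f = f * e) := by
  refine ⟨⟨CStarBimod.S.mul_assoc, fun s => ?_⟩, fun s => ?_, CStarBimod.S.ofIdeal_injective,
    fun s => ⟨CStarBimod.S.exists_ofIdeal_eq, ?_⟩, CStarBimod.S.ofIdeal_mul_ofIdeal,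
    fun e f => CStarBimod.S.mul_comm_of_idempotent⟩
  · obtain ⟨t, h1, h2, -⟩ := CStarBimod.S.exists_inverse s
    exact ⟨t, ⟨h1, h2⟩, fun t' h' => CStarBimod.S.inverse_unique h'.1 h'.2 h1 h2⟩
  · obtain ⟨t, h1, h2, -⟩ := CStarBimod.S.exists_inverse s
    exact ⟨t, h1, h2⟩
  · rintro ⟨J, rfl⟩
    exact CStarBimod.S.ofIdeal_mul_self J
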